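/- **Graphs on $\mathbb Z$.** Let $\mathcal G$ be the set of locally finite simple graphs $g=(V,E)$ with $V\subset\mathbb Z$, with the $\sigma$-algebra generated by the events $\{x\in V\}$ and $\{\{x,y\}\in E\}$, and let $d_g$ be the graph distance in $g$ (with $d_g(x,y)=\infty$ if $x,y$ are not connected). For a finite $g\in\mathcal G$ put $$\mathcal H_p(g)=\Big(\tfrac{1}{\binom{|V|}{2}}\sum_{x,y\in V,\;x<y} d_g(x,y)^p\Big)^{1/p}\quad(1\le p<\infty),\qquad \mathcal H_\infty(g)=\sup_{x,y\in V}d_g(x,y).$$ **Measures.** For $\gamma>0$ and $N\ge 1$, let $\mathbb P_{N,\gamma}$ be the law of the random graph with vertex set $[N]=\{1,\dots,N\}$ that contains all edges $\{x,y\}$ with $|x-y|=1$ and contains each edge $\{x,y\}$ with $|x-y|>1$ independently with probability $\exp\{-|x-y|^\gamma\}$. Let $\mathbb P_\gamma$ be the law of the random graph defined in the same way with vertex set $\mathbb Z$ (it is almost surely locally finite). For $b\in\mathbb R$ and $p\in[1,\infty]$ let $$\mathbb P^{b,p}_{N,\gamma}(g)=\frac{1}{Z^{b,p}_{N,\gamma}}\exp\{-N^b\,\mathcal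 H_p(g)\}\,\mathbb P_{N,\gamma}(g),$$ where $Z^{b,p}_{N,\gamma}$ is the normalizing constant. **Local convergence.** For $g=(V,E)\in\mathcal G$, $o\in V$ and $R>0$, let $B_{(g,o)}(R)$ be the subgraph of $g$ induced by $\{x\in V: d_g(o,x)\le R\}$, rooted at $o$. Write $(g,o)\simeq(g',o')$ if the translation $x\mapsto x-o+o'$ of $\mathbb Z$ maps $g$ onto $g'$ (vertices onto vertices and edges onto edges). Random rooted graphs $(G_N,\mathcal O_N)$, with laws $\mu_N$, are said to *converge locally in distribution* to a random rooted graph $(G,\mathcal O)$, with law $\mu$, if for every $R>0$ and every deterministic rooted graph $(g,o)$ with $g\in\mathcal G$ and $o$ a vertex of $g$, $$\lim_{N\to\infty}\mu_N\big(B_{(G_N,\mathcal O_N)}(R)\simeq(g,o)\big)=\mu\big(B_{(G,\mathcal O)}(R)\simeq(g,o)\big).$$ **Exceptional set.** For $p\in[1,\infty]$ let $$\mathcal E_p=\begin{cases}\displaystyle\bigcup_{k=1}^\infty\Big[\tfrac{k-1}{k},\ \tfrac{k-1}{k}+\Big(0\vee\tfrac{2p-(p-1)k}{k(k+1)(k+2p)}\Big)\Big]&\text{if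 }p<\infty,\\[2mm] [0,\tfrac14]\cup\bigcup_{k=2}^\infty\{\tfrac{k-1}{k}\}&\text{if }p=\infty.\end{cases}$$ **Theorem.** Let $p\in[1,\infty]$ and assume that one of the following holds: * $\gamma\in(0,1)$ and $b\in(-\infty,1)$; * $\gamma=1$ and $b\in(-\infty,1)\setminus\mathcal E_p$; * $\gamma>1$ and $b\in(-\infty,0)$. Let $\mathcal U_N$ be the uniform measure on $\{1,\dots,N\}$. Then $(G_N,\mathcal O_N)$ sampled from $\mathbb P^{b,p}_{N,\gamma}\otimes\mathcal U_N$ converges locally in distribution to $(G,\mathcal O)$ sampled from $\mathbb P_\gamma\otimes\delta_0$. -/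

import Mathlib

open MeasureTheory ProbabilityTheory Filter Topology Set
open scoped ENNReal

noncomputable section

namespace SpatialGibbs

/-- A simple graph `(V, E)` with vertex set `V ⊆ ℤ`, i.e. a subgraph of the complete graph on `ℤ`. -/
abbrev GraphOnZ : Type := (⊤ : SimpleGraph ℤ).Subgraph

/-- The σ-algebra generated by the events `{x ∈ V}` and `{{x, y} ∈ E}`. -/
instance : MeasurableSpace GraphOnZ :=
  MeasurableSpace.comap
    (fun g => ((fun x => x ∈ g.verts, fun x y => g.Adj x y) : (ℤ → Prop) × (ℤ → ℤ → Prop)))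
    inferInstance

/-- Every vertex has finitely many neighbours. -/
def IsLocallyFinite (g : GraphOnZ) : Prop :=
  ∀ v ∈ g.verts, (g.neighborSet v).Finite

/-- The set `𝒢` of locally finite graphs with vertex set contained in `ℤ`. -/
abbrev LFGraph : Type := {g : GraphOnZ // IsLocallyFinite g}

/-- The graph distance between two vertices; it is `∞` if no path joins them. -/
def gdist (g : GraphOnZ) (x y : ℤ) : ℝ≥0∞ :=
  (g.spanningCoe.edist x y : ℝ≥0∞)

/-- The functional `ℋ_p`: the normalised `ℓ^p`-average of the distances over the pairs `x < y` of
vertices if `p < ∞`, and the diameter if `p = ∞`. It is meant for finite graphs. -/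
def energy (p : ℝ≥0∞) (g : GraphOnZ) : ℝ≥0∞ :=
  if p = ∞ then ⨆ x ∈ g.verts, ⨆ y ∈ g.verts, gdist g x y
  else
    (((g.verts.ncard.choose 2 : ℕ) : ℝ≥0∞)⁻¹ *
      ∑' q : {q : ℤ × ℤ // q.1 ∈ g.verts ∧ q.2 ∈ g.verts ∧ q.1 < q.2},
        gdist g q.1.1 q.1.2 ^ p.toReal) ^ (1 / p.toReal)

/-- The length `|x - y|` of an unordered pair `{x, y}` of integers. -/
def edgeLength (e : Sym2 ℤ) : ℤ :=
  Sym2.lift ⟨fun x y => |x - y|, fun x y => abs_sub_comm x y⟩ e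

lemma edgeLength_nonneg (e : Sym2 ℤ) : 0 ≤ edgeLength e := by
  induction e with
  | _ x y => exact abs_nonneg (x - y)

lemma exp_edgeLength_mem (γ : ℝ) (e : Sym2 ℤ) :
    Real.exp (-((edgeLength e : ℝ) ^ γ)) ∈ unitInterval :=
  ⟨(Real.exp_pos _).le, Real.exp_le_one_iff.2 (neg_nonpos.2
    (Real.rpow_nonneg (Int.cast_nonneg (edgeLength_nonneg e)) γ))⟩

/-- The edge probability `exp (-|x - y|^γ)`, as an element of the unit interval. -/
def edgeProb (γ : ℝ) (e : Sym2 ℤ) : unitInterval :=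
  ⟨Real.exp (-((edgeLength e : ℝ) ^ γ)), exp_edgeLength_mem γ e⟩

/-- The product measure on edge configurations: the pairs `e` are open independently of each other,
each with probability `edgeProb γ e`. -/
def edgeMeasure (γ : ℝ) : Measure (Sym2 ℤ → Bool) :=
  Measure.infinitePi fun e => bernoulliMeasure true false (edgeProb γ e)

/-- The graph with vertex set `V` in which `x ≠ y` in `V` are joined if `|x - y| = 1` or if the pair
`{x, y}` is open in the configuration `ω`. -/
def graphOf (V : Set ℤ) (ω : Sym2 ℤ → Bool) : GraphOnZ where
  verts := V
  Adj x y := x ∈ V ∧ y ∈ V ∧ x ≠ y ∧ (|x - y| = 1 ∨ ω s(x, y) = true)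
  adj_sub h := h.2.2.1
  edge_vert h := h.1
  symm := ⟨fun x y h => ⟨h.2.1, h.1, h.2.2.1.symm, by
    rw [abs_sub_comm, Sym2.eq_swap]; exact h.2.2.2⟩⟩

/-- The reference measure on `𝒢` with vertex set `V`: all nearest-neighbour edges in `V` are present,
and the other edges are present independently with probabilities `exp (-|x - y|^γ)`.
It is the law of `graphOf V ω`, which is almost surely locally finite, viewed on `𝒢`. -/
def refMeasure (γ : ℝ) (V : Set ℤ) : Measure LFGraph :=
  ((edgeMeasure γ).map (graphOf V)).comap Subtype.val

/-- The vertex set `[N] = {1, …, N}`. -/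
def segment (N : ℕ) : Set ℤ := Set.Icc 1 (N : ℤ)

/-- The reference measure `ℙ_{N,γ}` on graphs with vertex set `[N]`. -/
def finiteRef (N : ℕ) (γ : ℝ) : Measure LFGraph := refMeasure γ (segment N)

/-- The infinite-volume reference measure `ℙ_γ` on graphs with vertex set `ℤ`. -/
def infiniteRef (γ : ℝ) : Measure LFGraph := refMeasure γ Set.univ

/-- The spatial Gibbs measure `ℙ^{b,p}_{N,γ}`: the probability measure with density proportional to
`exp (-N^b ℋ_p)` with respect to `ℙ_{N,γ}`. (Under `ℙ_{N,γ}` the graph is finite and connected, so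
`ℋ_p` is finite.) -/
def gibbs (N : ℕ) (γ b : ℝ) (p : ℝ≥0∞) : Measure LFGraph :=
  (finiteRef N γ).tilted fun g => -((N : ℝ) ^ b * (energy p g.1).toReal)

/-- The set of vertices and edges of the ball of radius `R` around `o` in `g`, as a graph. -/
def ball (g : GraphOnZ) (o : ℤ) (R : ℝ) : GraphOnZ :=
  g.induce {x | x ∈ g.verts ∧ gdist g o x ≤ ENNReal.ofReal R}

/-- The translation `φ_{o,o'}(x) = x - o + o'`. -/
def shift (o o' x : ℤ) : ℤ := x - o + o'

/-- The image of a graph under the translation `φ_{o,o'}`. -/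
def translate (o o' : ℤ) (g : GraphOnZ) : GraphOnZ where
  verts := shift o o' '' g.verts
  Adj := Relation.Map g.Adj (shift o o') (shift o o')
  adj_sub := by
    rintro _ _ ⟨x, y, h, rfl, rfl⟩
    have hxy : x ≠ y := g.adj_sub h
    simpa [shift] using hxy
  edge_vert := by
    rintro _ _ ⟨x, y, h, rfl, rfl⟩
    exact ⟨x, g.edge_vert h, rfl⟩
  symm := ⟨by
    rintro _ _ ⟨x, y, h, rfl, rfl⟩
    exact ⟨y, x, h.symm, rfl, rfl⟩⟩

/-- The relation `(g, o) ≃ (g', o')` between rooted graphs: the translation taking `o` to `o'` takes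
`g` to `g'`. -/
def RootedEq (g : GraphOnZ) (o : ℤ) (g' : GraphOnZ) (o' : ℤ) : Prop :=
  translate o o' g = g'

/-- Local convergence in distribution of random rooted graphs on `ℤ`, given through the laws `μ N`
and `ν` of the pairs (graph, root): for every `R > 0` and every deterministic rooted graph `(g, o)`
with `g` locally finite and `o` a vertex of `g`, the probability that the ball of radius `R` around
the root is a translate of `(g, o)` converges. -/
def LocallyConvergesInDistribution (μ : ℕ → Measure (LFGraph × ℤ)) (ν : Measure (LFGraph × ℤ)) :
    Prop :=
  ∀ R : ℝ, 0 < R → ∀ (g : LFGraph) (o : ℤ), o ∈ g.1.verts →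
    Tendsto (fun N => μ N {q | RootedEq (ball q.1.1 q.2 R) q.2 g.1 o}) atTop
      (𝓝 (ν {q | RootedEq (ball q.1.1 q.2 R) q.2 g.1 o}))

/-- The exceptional set `ℰ_p`. -/
def exceptionalSet (p : ℝ≥0∞) : Set ℝ :=
  if p = ∞ then
    Set.Icc 0 (1 / 4) ∪ ⋃ k : ℕ, ⋃ _ : 2 ≤ k, {((k : ℝ) - 1) / k}
  else
    ⋃ k : ℕ, ⋃ _ : 1 ≤ k,
      Set.Icc (((k : ℝ) - 1) / k)
        (((k : ℝ) - 1) / k +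
          max 0 ((2 * p.toReal - (p.toReal - 1) * k) / (k * (k + 1) * (k + 2 * p.toReal))))

end SpatialGibbs

end

/-! Fix a finite rooted pattern and let `patternCount` be the number of vertices of [N] whose ball
is a translate of it. Averaging over the uniform root turns the theorem into a statement about
`patternCount / N` under the Gibbs weight: it must converge to the probability q of the pattern at 0
under the infinite product measure. The reason is a separation of scales: the Hamiltonian may force
long edges, but these are too sparse to disturb most neighbourhoods, and they are independent of the
short edges that decide the pattern.

Quantitatively (`tendsto_gibbs_patternCount`), suppose that for some m ≥ 0 the normalizing constant
Z is at least exp(-(m + o(1)) N), while small energy forces an event T of edges of length ≥ K with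
probability at most exp(-(m - o(1)) N). By `exists_patternCount_deviation`, an atypical frequency
needs either an excess of long edges, of probability at most exp(-(m + 1) N) once K is large, or an
event Q of edges shorter than K, of probability at most C exp(-c' N). Since Q and T are independent,
both contributions are negligible against Z.

Lower bound on Z: open M layers of edges, the layer j joining consecutive points of 1 + L^j ℕ, with
L ≈ N^(1/(M+1)). The diameter becomes O(L) and the probability is at least exp(-M N L^(γ-1)). This
gives m = 0 if b < 0 (M = 0) or γ < 1 (M large), and m = k if γ = 1 and (k-1)/k < b < k/(k+1) (M =
k).

Upper bound on T: for m = 0 the whole space will do. For γ = 1, small energy puts most vertices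
within distance t = O(N^(1-b)) of some o. If the long edges had total length below (k - η) N, a
positive fraction of the gaps (v, v+1) would be crossed by at most k - 1 of them. In a breadth-first
tree of depth t, `card_le_of_crossing_le` allows only O(K t^k) = o(N) such v, because (1-b)k < 1. So
the long edges have total length about k N, which costs exp(-(k - o(1)) N) by an exponential Markov
bound. -/

namespace SpatialGibbs

/-! ### Thin cuts in graphs with short paths -/

/-- The edges of `T` of length at least `K` that cross the gap between `v` and `v + 1`. -/
def crossing (T : SimpleGraph ℤ) (K : ℤ) (v : ℤ) : Set (ℤ × ℤ) :=
  {q | T.Adj q.1 q.2 ∧ q.1 ≤ v ∧ v < q.2 ∧ K ≤ q.2 - q.1}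

theorem crossing_mono {T T' : SimpleGraph ℤ} (h : T ≤ T') (K v : ℤ) :
    crossing T K v ⊆ crossing T' K v :=
  fun _ hq => ⟨h hq.1, hq.2⟩

/-- Follow the walk up to its first vertex in `S`: each edge before it has an endpoint outside `S`,
so it is not in `E`. -/
theorem exists_reachable_deleteEdges {V : Type*} {T : SimpleGraph V} (S : Set V) (E : Set (Sym2 V))
    (hE : ∀ e ∈ E, ∀ x ∈ e, x ∈ S) {v a : V} (q : T.Walk v a) (ha : a ∈ S) :
    ∃ w ∈ S, (T.deleteEdges E).Reachable v w := by
  induction q with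
  | nil => exact ⟨_, ha, .refl _⟩
  | @cons v z a h q ih =>
    by_cases hv : v ∈ S
    · exact ⟨v, hv, .refl _⟩
    · obtain ⟨w, hw, hr⟩ := ih ha
      refine ⟨w, hw, SimpleGraph.Reachable.trans (SimpleGraph.Adj.reachable ?_) hr⟩
      rw [SimpleGraph.deleteEdges_adj]
      exact ⟨h, fun he => hv (hE _ he v (Sym2.mem_mk_left v z))⟩

/-- In a graph whose paths have length at most `D`, a connected set of vertices at each of which the
cut contains at most `j` edges of length at least `K` has at most `(D K + 1) (D + 2) ^ j`
elements. -/
theorem card_le_of_crossing_le (D K j : ℕ) (T : SimpleGraph ℤ)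
    (hD : ∀ u v (p : T.Walk u v), p.IsPath → p.length ≤ D) (A : Finset ℤ)
    (hA : ∀ u ∈ A, ∀ v ∈ A, T.Reachable u v)
    (hj : ∀ v ∈ A, (crossing T K v).encard ≤ j) : A.card ≤ (D * K + 1) * (D + 2) ^ j := by
  classical
  induction j using Nat.strong_induction_on generalizing T A with
  | _ j ih =>
  rcases A.eq_empty_or_nonempty with rfl | hne
  · simp
  obtain ⟨p, hp⟩ := (hA _ (A.min'_mem hne) _ (A.max'_mem hne)).exists_isPath
  have hlen := hD _ _ p hp
  -- The path from min A to max A crosses the gap after every v of A other than the maximum. `S`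
  -- collects the gaps crossed rightwards by a short step: at most D steps, each over at most K gaps
  -- (leftward steps give an empty interval). `A'` collects the remaining points, where the path
  -- crosses by a long edge.
  let S : Finset ℤ := p.darts.toFinset.biUnion
    fun d => if d.snd - d.fst < K then Finset.Ico d.fst d.snd else ∅
  have hS : S.card ≤ D * K := by
    refine (Finset.card_biUnion_le_card_mul _ _ K ?_).trans ?_
    · intro d _
      split_ifs with h
      · rw [Int.card_Ico]; omega
      · simp
    · gcongr
      exact (List.toFinset_card_le _).trans (by simpa using hlen)
  let A' : Finset ℤ := A.filter fun v => ∃ d ∈ p.darts, d.fst ≤ v ∧ v < d.snd ∧ (K : ℤ) ≤ d.snd - d.fst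
  have hcov : A ⊆ insert (A.max' hne) (S ∪ A') := by
    intro v hv
    rw [Finset.mem_insert, Finset.mem_union]
    by_cases hvm : v = A.max' hne
    · exact Or.inl hvm
    right
    have hlt : v < A.max' hne := lt_of_le_of_ne (A.le_max' v hv) hvm
    obtain ⟨d, hd, h1, h2⟩ := p.exists_boundary_dart {x | x ≤ v} (A.min'_le v hv)
      (not_le.2 hlt)
    simp only [Set.mem_ofPred_eq, not_le] at h1 h2
    by_cases hK : d.snd - d.fst < K
    · left
      refine Finset.mem_biUnion.2 ⟨d, by simpa using hd, ?_⟩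
      rw [if_pos hK, Finset.mem_Ico]
      exact ⟨h1, h2⟩
    · right
      exact Finset.mem_filter.2 ⟨hv, d, hd, h1, h2, not_lt.1 hK⟩
  have hcard : A.card ≤ D * K + 1 + A'.card := by
    have h1 := Finset.card_le_card hcov
    have h2 := Finset.card_insert_le (A.max' hne) (S ∪ A')
    have h3 := Finset.card_union_le S A'
    omega
  rcases j with _ | j
  · have : A' = ∅ := by
      refine Finset.filter_eq_empty_iff.2 ?_
      rintro v hv ⟨d, hd, h1, h2, h3⟩
      have h := hj v hv
      simp only [Nat.cast_zero, nonpos_iff_eq_zero, Set.encard_eq_zero] at h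
      have hmem : (d.fst, d.snd) ∈ crossing T K v := ⟨d.adj, h1, h2, h3⟩
      rw [h] at hmem
      exact hmem
    simpa [this] using hcard
  -- Deleting the path removes a long edge from the cut at each point of `A'`, so the induction
  -- hypothesis applies with one crossing fewer. The price is that A' falls apart; but every piece
  -- still hangs on one of the at most D + 1 vertices of the path.
  · let T' := T.deleteEdges {e | e ∈ p.edges}
    have hT' : T' ≤ T := SimpleGraph.deleteEdges_le _
    have hD' : ∀ u v (q : T'.Walk u v), q.IsPath → q.length ≤ D := fun u v q hq => by
      simpa using hD u v (q.mapLe hT') ((SimpleGraph.Walk.isPath_mapLe hT').2 hq)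
    have hcl : ∀ v : ℤ, ∃ w, v ∈ A → w ∈ p.support ∧ T'.Reachable v w := by
      intro v
      by_cases hv : v ∈ A
      · obtain ⟨q⟩ := hA v hv _ (A.min'_mem hne)
        obtain ⟨w, hw, hr⟩ := exists_reachable_deleteEdges {x | x ∈ p.support} {e | e ∈ p.edges}
          (fun e he x hx => SimpleGraph.Walk.mem_support_of_mem_edges he hx) q
          (SimpleGraph.Walk.start_mem_support p)
        exact ⟨w, fun _ => ⟨hw, hr⟩⟩
      · exact ⟨0, fun h => absurd h hv⟩
    choose f hf using hcl
    -- The fibre of `f` over w is connected in `T'` through w.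
    have hA' : A'.card ≤ (D * K + 1) * (D + 2) ^ j * p.support.toFinset.card := by
      refine Finset.card_le_mul_card_image_of_maps_to (f := f)
        (fun v hv => List.mem_toFinset.2 (hf v (Finset.mem_filter.1 hv).1).1) _ ?_
      intro w _
      refine ih j j.lt_succ_self T' hD' _ ?_ ?_
      · intro u hu v hv
        simp only [Finset.mem_filter] at hu hv
        have h1 := (hf u hu.1.1).2
        have h2 := (hf v hv.1.1).2
        rw [hu.2] at h1
        rw [hv.2] at h2
        exact h1.trans h2.symm
      · intro v hv
        simp only [Finset.mem_filter] at hv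
        obtain ⟨⟨hvA, d, hd, h1, h2, h3⟩, -⟩ := hv
        have hfin : (crossing T' K v).Finite :=
          (Set.finite_of_encard_le_coe (hj v hvA)).subset (crossing_mono hT' K v)
        have hlt : (crossing T' K v).encard < (crossing T K v).encard := by
          refine hfin.encard_lt_encard ⟨crossing_mono hT' K v, fun hsub => ?_⟩
          have hmem : (d.fst, d.snd) ∈ crossing T' K v := hsub ⟨d.adj, h1, h2, h3⟩
          have := (SimpleGraph.deleteEdges_adj.1 hmem.1).2
          exact this (List.mem_map.2 ⟨d, hd, rfl⟩)
        have := hlt.trans_le (hj v hvA)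
        exact Order.le_of_lt_add_one (by simpa using this)
    have hsup : p.support.toFinset.card ≤ D + 1 :=
      (List.toFinset_card_le _).trans (by simpa using hlen)
    calc A.card ≤ D * K + 1 + (D * K + 1) * (D + 2) ^ j * (D + 1) :=
          hcard.trans (by gcongr; exact hA'.trans (by gcongr))
      _ ≤ (D * K + 1) * (D + 2) ^ j + (D * K + 1) * (D + 2) ^ j * (D + 1) := by
          gcongr
          exact Nat.le_mul_of_pos_right _ (by positivity)
      _ = _ := by ring

/-! ### Breadth-first trees -/

/-- Here `par` and `h` make `T` a rooted forest. A path that avoids the parent of its start can only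
descend: after each step the parent of the new vertex is the vertex just left, which a path does not
revisit. -/
theorem length_add_height_eq {V : Type*} {T : SimpleGraph V} {par : V → V} {h : V → ℕ}
    (hT : ∀ x y, T.Adj x y → (par x = y ∧ h x = h y + 1) ∨ (par y = x ∧ h y = h x + 1))
    {u v : V} (p : T.Walk u v) (hp : p.IsPath) (hu : par u ∉ p.support) : p.length + h u = h v := by
  induction p with
  | nil => simp
  | @cons u z v huz q ih =>
    rw [SimpleGraph.Walk.cons_isPath_iff] at hp
    rcases hT u z huz with ⟨h1, -⟩ | ⟨h1, h2⟩
    · exact absurd (by rw [h1, SimpleGraph.Walk.support_cons]; exact List.mem_cons_of_mem _ q.start_mem_support) hu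
    · have := ih hp.1 (h1 ▸ hp.2)
      rw [SimpleGraph.Walk.length_cons]
      omega

/-- A path climbs for a while and then only descends; the climb uses up the height of `u`, the
descent is bounded by the height of `v`. -/
theorem length_le_height_add {V : Type*} {T : SimpleGraph V} {par : V → V} {h : V → ℕ}
    (hT : ∀ x y, T.Adj x y → (par x = y ∧ h x = h y + 1) ∨ (par y = x ∧ h y = h x + 1))
    {u v : V} (p : T.Walk u v) (hp : p.IsPath) : p.length ≤ h u + h v := by
  induction p with
  | nil => simp
  | @cons u z v huz q ih =>
    rw [SimpleGraph.Walk.cons_isPath_iff] at hp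
    rw [SimpleGraph.Walk.length_cons]
    rcases hT u z huz with ⟨-, h2⟩ | ⟨h1, h2⟩
    · have := ih hp.1
      omega
    · have := length_add_height_eq hT q hp.1 (h1 ▸ hp.2)
      omega

/-- The first step of a geodesic from `y` to `o`; it serves as the parent of `y`. -/
theorem exists_adj_dist_add_one {V : Type*} {G : SimpleGraph V} {o y : V} (hr : G.Reachable o y)
    (hy : y ≠ o) : ∃ z, G.Adj y z ∧ G.Reachable o z ∧ G.dist o z + 1 = G.dist o y := by
  obtain ⟨p, hp⟩ := hr.symm.exists_walk_length_eq_dist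
  cases p with
  | nil => exact absurd rfl hy
  | @cons _ z _ h q =>
    refine ⟨z, h, q.reachable.symm, ?_⟩
    rw [SimpleGraph.Walk.length_cons] at hp
    have h1 := SimpleGraph.dist_le q
    obtain ⟨r, hr⟩ := q.reachable.exists_walk_length_eq_dist
    have h2 := SimpleGraph.dist_le (SimpleGraph.Walk.cons h r)
    rw [SimpleGraph.Walk.length_cons] at h2
    rw [SimpleGraph.dist_comm, SimpleGraph.dist_comm (u := o)]
    omega

/-- A breadth-first search tree of depth `t`. -/
theorem exists_le_forall_path_length_le {V : Type*} (G : SimpleGraph V) (o : V) (t : ℕ) :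
    ∃ T ≤ G, (∀ u v (p : T.Walk u v), p.IsPath → p.length ≤ 2 * t) ∧
      ∀ y, G.Reachable o y → G.dist o y ≤ t → T.Reachable o y := by
  classical
  have hpar : ∀ y, ∃ z, G.Reachable o y → y ≠ o →
      G.Adj y z ∧ G.Reachable o z ∧ G.dist o z + 1 = G.dist o y := by
    intro y
    by_cases hy : G.Reachable o y ∧ y ≠ o
    · obtain ⟨z, hz⟩ := exists_adj_dist_add_one hy.1 hy.2
      exact ⟨z, fun _ _ => hz⟩
    · exact ⟨y, fun h1 h2 => absurd ⟨h1, h2⟩ hy⟩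
  choose par hpar using hpar
  let Q : V → V → Prop := fun x y => G.Reachable o x ∧ x ≠ o ∧ G.dist o x ≤ t ∧ par x = y
  let T : SimpleGraph V :=
    { Adj := fun x y => Q x y ∨ Q y x
      symm := ⟨fun x y h => Or.symm h⟩
      loopless := ⟨fun x h => by
        have h : Q x x := h.elim id id
        have h' := (hpar x h.1 h.2.1).1
        rw [h.2.2.2] at h'
        exact G.irrefl h'⟩ }
  have hQ : ∀ x y, Q x y → G.Adj x y := fun x y h => h.2.2.2 ▸ (hpar x h.1 h.2.1).1
  -- Only vertices within distance t of o are joined to their parents, so the distance truncated at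
  -- t is still a height function. It is at most t everywhere, whence the bound 2t on path lengths.
  have hQh : ∀ x y, Q x y → par x = y ∧ min (G.dist o x) t = min (G.dist o y) t + 1 := by
    rintro x y ⟨h1, h2, h3, rfl⟩
    have := (hpar x h1 h2).2.2
    exact ⟨rfl, by omega⟩
  have hTG : T ≤ G := by
    rintro x y (h | h)
    exacts [hQ x y h, (hQ y x h).symm]
  refine ⟨T, hTG, ?_, ?_⟩
  · intro u v p hp
    have := length_le_height_add (par := par) (h := fun x => min (G.dist o x) t)
      (fun x y (h : Q x y ∨ Q y x) => h.imp (hQh x y) (hQh y x)) p hp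
    omega
  · intro y hy hyt
    generalize hn : G.dist o y = n
    induction n generalizing y with
    | zero =>
      rw [hy.dist_eq_zero_iff.1 hn]
    | succ n ih =>
      have hyo : y ≠ o := by
        rintro rfl
        simp at hn
      obtain ⟨h1, h2, h3⟩ := hpar y hy hyo
      have h4 := ih (par y) h2 (by omega) (by omega)
      refine h4.trans (SimpleGraph.Adj.reachable ?_)
      exact Or.inr ⟨hy, hyo, hyt, rfl⟩

/-! ### Balls and translations -/

/-- There is a walk of length at most `n` from `x` to `y`. -/
def Within (g : GraphOnZ) (n : ℕ) (x y : ℤ) : Prop :=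
  ∃ p : g.spanningCoe.Walk x y, p.length ≤ n

theorem within_self (g : GraphOnZ) (n : ℕ) (x : ℤ) : Within g n x x := ⟨.nil, Nat.zero_le _⟩

theorem Within.mono {g : GraphOnZ} {m n : ℕ} {x y : ℤ} (h : Within g m x y) (hmn : m ≤ n) :
    Within g n x y :=
  h.imp fun _ hp => hp.trans hmn

theorem Within.symm {g : GraphOnZ} {n : ℕ} {x y : ℤ} (h : Within g n x y) : Within g n y x := by
  obtain ⟨p, hp⟩ := h
  exact ⟨p.reverse, by simpa using hp⟩

theorem Within.trans {g : GraphOnZ} {m n : ℕ} {x y z : ℤ} (h : Within g m x y)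
    (h' : Within g n y z) : Within g (m + n) x z := by
  obtain ⟨p, hp⟩ := h
  obtain ⟨q, hq⟩ := h'
  exact ⟨p.append q, by rw [SimpleGraph.Walk.length_append]; omega⟩

theorem within_zero_iff {g : GraphOnZ} {x y : ℤ} : Within g 0 x y ↔ y = x := by
  constructor
  · rintro ⟨p, hp⟩
    exact (SimpleGraph.Walk.eq_of_length_eq_zero (Nat.le_zero.1 hp)).symm
  · rintro rfl
    exact within_self g 0 y

/-- Recursion on the last step. It drives the inductions on the radius and expresses distance events
by countable operations on adjacency. -/
theorem within_succ_iff {g : GraphOnZ} {n : ℕ} {x y : ℤ} :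
    Within g (n + 1) x y ↔ y = x ∨ ∃ z, Within g n x z ∧ g.Adj z y := by
  constructor
  · intro h
    obtain ⟨p, hp⟩ := h.symm
    cases p with
    | nil => exact Or.inl rfl
    | @cons _ z _ hz q =>
      rw [SimpleGraph.Walk.length_cons] at hp
      exact Or.inr ⟨z, Within.symm ⟨q, by omega⟩, hz.symm⟩
  · rintro (rfl | ⟨z, h, hz⟩)
    · exact within_self _ _ _
    · exact h.trans (n := 1) ⟨SimpleGraph.Walk.cons (show g.spanningCoe.Adj z y from hz) .nil, by simp⟩

theorem gdist_le_natCast_iff {g : GraphOnZ} {n : ℕ} {x y : ℤ} :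
    gdist g x y ≤ n ↔ Within g n x y := by
  have : (n : ℝ≥0∞) = ((n : ℕ∞) : ℝ≥0∞) := by simp
  rw [gdist, this, ENat.toENNReal_le]
  constructor
  · intro h
    obtain ⟨p, hp⟩ := SimpleGraph.exists_walk_of_edist_ne_top
      (ne_top_of_le_ne_top (ENat.natCast_ne_top n) h)
    exact ⟨p, by rw [← hp] at h; exact_mod_cast h⟩
  · rintro ⟨p, hp⟩
    exact (SimpleGraph.edist_le p).trans (by exact_mod_cast hp)

theorem gdist_le_ofReal_iff {g : GraphOnZ} {R : ℝ} (hR : 0 ≤ R) {x y : ℤ} :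
    gdist g x y ≤ ENNReal.ofReal R ↔ Within g ⌊R⌋₊ x y := by
  rw [← gdist_le_natCast_iff]
  constructor
  · intro h
    rw [gdist] at h ⊢
    generalize g.spanningCoe.edist x y = d at h ⊢
    induction d with
    | top => simp at h
    | coe d =>
      simp only [ENat.toENNReal_coe] at h ⊢
      rw [← ENNReal.ofReal_natCast, ENNReal.ofReal_le_ofReal_iff hR] at h
      exact_mod_cast Nat.le_floor h
  · intro h
    refine h.trans ?_
    rw [← ENNReal.ofReal_natCast]
    exact ENNReal.ofReal_le_ofReal (Nat.floor_le hR)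

theorem mem_ball_verts_iff {g : GraphOnZ} {o x : ℤ} {R : ℝ} (hR : 0 ≤ R) :
    x ∈ (ball g o R).verts ↔ x ∈ g.verts ∧ Within g ⌊R⌋₊ o x := by
  rw [← gdist_le_ofReal_iff hR]
  rfl

theorem ball_adj_iff {g : GraphOnZ} {o x y : ℤ} {R : ℝ} :
    (ball g o R).Adj x y ↔ x ∈ (ball g o R).verts ∧ y ∈ (ball g o R).verts ∧ g.Adj x y :=
  Iff.rfl

theorem Within.mem_verts {g : GraphOnZ} {n : ℕ} {o x : ℤ} (h : Within g n o x) (ho : o ∈ g.verts) :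
    x ∈ g.verts := by
  cases n with
  | zero => exact within_zero_iff.1 h ▸ ho
  | succ n =>
    rcases within_succ_iff.1 h with rfl | ⟨z, -, hz⟩
    exacts [ho, hz.snd_mem]

/-- The ball around `o` depends only on the edges that touch it. -/
theorem ball_eq_of_adj_iff {g g' : GraphOnZ} {o : ℤ} {R : ℝ} (hR : 0 ≤ R) (ho : o ∈ g.verts)
    (hv : ∀ x ∈ (ball g o R).verts, x ∈ g'.verts)
    (h : ∀ x ∈ (ball g o R).verts, ∀ y, g.Adj x y ↔ g'.Adj x y) : ball g' o R = ball g o R := by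
  -- Agreement of the adjacencies is used only at vertices reached in fewer than `⌊R⌋₊` steps, and
  -- these lie in the ball of `g`.
  have key : ∀ n ≤ ⌊R⌋₊, ∀ y, Within g' n o y ↔ Within g n o y := by
    intro n
    induction n with
    | zero => intro _ y; rw [within_zero_iff, within_zero_iff]
    | succ n ih =>
      intro hn y
      rw [within_succ_iff, within_succ_iff]
      refine or_congr_right (exists_congr fun z => ?_)
      rw [ih (by omega)]
      refine and_congr_right fun hz => ?_
      exact (h z ((mem_ball_verts_iff hR).2 ⟨hz.mem_verts ho, hz.mono (by omega)⟩) y).symm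
  have hverts : ∀ x, x ∈ (ball g' o R).verts ↔ x ∈ (ball g o R).verts := by
    intro x
    rw [mem_ball_verts_iff hR, key _ le_rfl, mem_ball_verts_iff hR]
    refine ⟨fun hx => ⟨hx.2.mem_verts ho, hx.2⟩, fun hx => ⟨hv x ((mem_ball_verts_iff hR).2 hx), hx.2⟩⟩
  refine SimpleGraph.Subgraph.ext (Set.ext hverts) ?_
  ext x y
  rw [ball_adj_iff, ball_adj_iff, hverts, hverts]
  refine and_congr_right fun hx => and_congr_right fun _ => (h x hx y).symm

theorem finite_setOf_within {g : GraphOnZ} (hg : IsLocallyFinite g) (n : ℕ) (o : ℤ) :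
    {x | Within g n o x}.Finite := by
  induction n with
  | zero => exact (Set.finite_singleton o).subset fun x hx => within_zero_iff.1 hx
  | succ n ih =>
    have : {x | Within g (n + 1) o x} ⊆ {o} ∪ ⋃ z ∈ {x | Within g n o x}, g.neighborSet z := by
      intro x hx
      rcases within_succ_iff.1 hx with rfl | ⟨z, hz, hzx⟩
      · exact Or.inl rfl
      · exact Or.inr (Set.mem_biUnion (show z ∈ {x | Within g n o x} from hz) hzx)
    refine ((Set.finite_singleton o).union (ih.biUnion fun z _ => ?_)).subset this
    by_cases hz : z ∈ g.verts
    · exact hg z hz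
    · exact Set.Finite.subset Set.finite_empty fun y hy => hz (SimpleGraph.Subgraph.Adj.fst_mem hy)

theorem finite_ball_verts {g : GraphOnZ} (hg : IsLocallyFinite g) {R : ℝ} (hR : 0 ≤ R) (o : ℤ) :
    (ball g o R).verts.Finite :=
  (finite_setOf_within hg ⌊R⌋₊ o).subset fun _ hx => ((mem_ball_verts_iff hR).1 hx).2

theorem translate_verts (a b : ℤ) (g : GraphOnZ) (x : ℤ) :
    x ∈ (translate a b g).verts ↔ x - b + a ∈ g.verts := by
  constructor
  · rintro ⟨y, hy, rfl⟩
    simpa [shift] using hy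
  · intro h
    exact ⟨_, h, by simp [shift]⟩

theorem translate_adj (a b : ℤ) (g : GraphOnZ) (x y : ℤ) :
    (translate a b g).Adj x y ↔ g.Adj (x - b + a) (y - b + a) := by
  constructor
  · rintro ⟨u, v, h, rfl, rfl⟩
    simpa [shift] using h
  · intro h
    exact ⟨_, _, h, by simp [shift], by simp [shift]⟩

theorem translate_translate (a b c : ℤ) (g : GraphOnZ) :
    translate b c (translate a b g) = translate a c g := by
  refine SimpleGraph.Subgraph.ext ?_ ?_
  · ext x
    simp only [translate_verts]
    ring_nf
  · ext x y
    simp only [translate_adj]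
    ring_nf

theorem translate_self (a : ℤ) (g : GraphOnZ) : translate a a g = g := by
  refine SimpleGraph.Subgraph.ext ?_ ?_
  · ext x
    simp [translate_verts]
  · ext x y
    simp [translate_adj]

/-- With the pattern moved instead of the ball, the event becomes equality with a fixed graph, which
is convenient for measurability. -/
theorem rootedEq_iff {g g' : GraphOnZ} {o o' : ℤ} : RootedEq g o g' o' ↔ g = translate o' o g' := by
  constructor
  · rintro rfl
    rw [translate_translate, translate_self]
  · rintro rfl
    rw [RootedEq, translate_translate, translate_self]

theorem within_translate (a b : ℤ) (g : GraphOnZ) (n : ℕ) (x y : ℤ) :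
    Within (translate a b g) n x y ↔ Within g n (x - b + a) (y - b + a) := by
  induction n generalizing y with
  | zero => rw [within_zero_iff, within_zero_iff]; omega
  | succ n ih =>
    rw [within_succ_iff, within_succ_iff]
    refine or_congr (by omega) ?_
    constructor
    · rintro ⟨z, h1, h2⟩
      exact ⟨_, (ih z).1 h1, (translate_adj ..).1 h2⟩
    · rintro ⟨z, h1, h2⟩
      refine ⟨z + b - a, (ih _).2 ?_, (translate_adj ..).2 ?_⟩
      · convert h1 using 1; ring
      · convert h2 using 1; ring

theorem ball_translate (a b : ℤ) (g : GraphOnZ) (o : ℤ) {R : ℝ} (hR : 0 ≤ R) :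
    ball (translate a b g) o R = translate a b (ball g (o - b + a) R) := by
  have hv : ∀ x, x ∈ (ball (translate a b g) o R).verts ↔
      x ∈ (translate a b (ball g (o - b + a) R)).verts := by
    intro x
    rw [mem_ball_verts_iff hR, translate_verts, translate_verts, mem_ball_verts_iff hR,
      within_translate]
  refine SimpleGraph.Subgraph.ext (Set.ext hv) ?_
  ext x y
  rw [translate_adj, ball_adj_iff, ball_adj_iff, hv, hv, translate_verts, translate_verts,
    translate_adj]

theorem rootedEq_ball_translate (a b : ℤ) (g g' : GraphOnZ) (o' : ℤ) {R : ℝ} (hR : 0 ≤ R) :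
    RootedEq (ball (translate a b g) b R) b g' o' ↔ RootedEq (ball g a R) a g' o' := by
  rw [ball_translate _ _ _ _ hR, RootedEq, RootedEq, translate_translate]
  simp

/-! ### Measurability -/

theorem measurable_mem_verts (x : ℤ) : Measurable fun g : GraphOnZ => x ∈ g.verts :=
  (measurable_pi_apply x).comp (measurable_fst.comp (comap_measurable _))

theorem measurable_adj (x y : ℤ) : Measurable fun g : GraphOnZ => g.Adj x y :=
  (measurable_pi_apply y).comp ((measurable_pi_apply x).comp
    (measurable_snd.comp (comap_measurable _)))

theorem measurable_within (n : ℕ) (x y : ℤ) : Measurable fun g : GraphOnZ => Within g n x y := by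
  induction n generalizing y with
  | zero => simp only [within_zero_iff]; exact measurable_const
  | succ n ih =>
    simp only [within_succ_iff]
    exact measurable_const.or (Measurable.exists fun z => (ih z).and (measurable_adj z y))

theorem measurable_mem_ball_verts (o x : ℤ) {R : ℝ} (hR : 0 ≤ R) :
    Measurable fun g : GraphOnZ => x ∈ (ball g o R).verts := by
  simp only [mem_ball_verts_iff hR]
  exact (measurable_mem_verts x).and (measurable_within _ _ _)

theorem measurableSet_eq_of_measurable {Ω : Type*} [MeasurableSpace Ω] {F : Ω → GraphOnZ}
    (hv : ∀ x, Measurable fun ω => x ∈ (F ω).verts)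
    (ha : ∀ x y, Measurable fun ω => (F ω).Adj x y) (g : GraphOnZ) :
    MeasurableSet {ω | F ω = g} := by
  have : {ω | F ω = g} = {ω | (∀ x, x ∈ (F ω).verts ↔ x ∈ g.verts) ∧
      ∀ x y, (F ω).Adj x y ↔ g.Adj x y} := by
    ext ω
    constructor
    · intro h
      have h : F ω = g := h
      exact ⟨fun x => by rw [h], fun x y => by rw [h]⟩
    · rintro ⟨h1, h2⟩
      exact SimpleGraph.Subgraph.ext (Set.ext h1) (by ext x y; exact h2 x y)
  rw [this]
  refine measurableSet_setOfPred.2 (Measurable.and ?_ ?_)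
  · exact Measurable.forall fun x => (hv x).iff measurable_const
  · exact Measurable.forall fun x => Measurable.forall fun y => (ha x y).iff measurable_const

theorem measurableSet_rootedEq_ball (o o' : ℤ) (g' : GraphOnZ) {R : ℝ} (hR : 0 ≤ R) :
    MeasurableSet {g : GraphOnZ | RootedEq (ball g o R) o g' o'} := by
  simp only [rootedEq_iff]
  refine measurableSet_eq_of_measurable (fun x => measurable_mem_ball_verts o x hR) (fun x y => ?_) _
  simp only [ball_adj_iff]
  exact (measurable_mem_ball_verts o x hR).and
    ((measurable_mem_ball_verts o y hR).and (measurable_adj x y))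

instance : MeasurableSingletonClass GraphOnZ :=
  ⟨fun g => measurableSet_eq_of_measurable measurable_mem_verts measurable_adj g⟩

theorem isLocallyFinite_iff (g : GraphOnZ) :
    IsLocallyFinite g ↔ ∀ v, v ∈ g.verts → ∃ n : ℕ, ∀ y, g.Adj v y → |y| ≤ n := by
  refine forall_congr' fun v => forall_congr' fun _ => ?_
  constructor
  · intro h
    obtain ⟨n, hn⟩ := (h.image fun y => |y|.toNat).bddAbove
    refine ⟨n, fun y hy => ?_⟩
    have : |y|.toNat ≤ n := hn ⟨y, hy, rfl⟩
    have h0 := abs_nonneg y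
    omega
  · rintro ⟨n, hn⟩
    exact (Set.finite_Icc (-(n : ℤ)) n).subset fun y hy => abs_le.1 (hn y hy)

theorem measurableSet_isLocallyFinite : MeasurableSet {g : GraphOnZ | IsLocallyFinite g} := by
  simp only [isLocallyFinite_iff]
  refine measurableSet_setOfPred.2 (Measurable.forall fun v => (measurable_mem_verts v).imp
    (Measurable.exists fun n => Measurable.forall fun y => (measurable_adj v y).imp
      measurable_const))

theorem measurable_graphOf (V : Set ℤ) : Measurable (graphOf V) := by
  refine measurable_comap_iff.2 (Measurable.prodMk ?_ ?_)
  · exact (measurable_const : Measurable fun _ : Sym2 ℤ → Bool => fun x : ℤ => x ∈ V)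
  · refine measurable_pi_lambda _ fun x => measurable_pi_lambda _ fun y => ?_
    refine measurable_const.and (measurable_const.and (measurable_const.and
      (measurable_const.or ?_)))
    exact measurableSet_setOfPred.1 ((measurableSet_singleton true).preimage (measurable_pi_apply s(x, y)))

theorem isLocallyFinite_graphOf_of_finite {V : Set ℤ} (hV : V.Finite) (ω : Sym2 ℤ → Bool) :
    IsLocallyFinite (graphOf V ω) :=
  fun _ _ => hV.subset fun _ hy => hy.2.1

/-! ### The product measure: independence and exponential bounds -/

instance (γ : ℝ) : IsProbabilityMeasure (edgeMeasure γ) := by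
  unfold edgeMeasure
  infer_instance

/-- Functions of finitely many edges factor through a finite cube, where measurability is automatic
and independence of disjoint edge sets is inherited from the coordinates. -/
theorem exists_comp_restrict_of_dependsOn {β : Type*} {f : (Sym2 ℤ → Bool) → β}
    {S : Finset (Sym2 ℤ)} (h : DependsOn f S) :
    ∃ φ : (S → Bool) → β, ∀ ω, f ω = φ fun e => ω e := by
  classical
  refine ⟨fun η => f fun e => if he : e ∈ S then η ⟨e, he⟩ else false, fun ω => ?_⟩
  refine h fun e he => ?_
  rw [dif_pos (by simpa using he)]

theorem measurable_of_dependsOn {β : Type*} [MeasurableSpace β] {f : (Sym2 ℤ → Bool) → β}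
    {S : Finset (Sym2 ℤ)} (h : DependsOn f S) : Measurable f := by
  obtain ⟨φ, hφ⟩ := exists_comp_restrict_of_dependsOn h
  rw [funext hφ]
  exact (measurable_of_finite φ).comp (measurable_pi_lambda _ fun e => measurable_pi_apply _)

theorem iIndepFun_edgeMeasure (γ : ℝ) :
    iIndepFun (fun (e : Sym2 ℤ) (ω : Sym2 ℤ → Bool) => ω e) (edgeMeasure γ) :=
  iIndepFun_infinitePi (X := fun _ b => b) fun _ => measurable_id

theorem indepFun_of_dependsOn {β β' : Type*} [MeasurableSpace β] [MeasurableSpace β'] (γ : ℝ)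
    {f : (Sym2 ℤ → Bool) → β} {g : (Sym2 ℤ → Bool) → β'} {S T : Finset (Sym2 ℤ)}
    (hf : DependsOn f S) (hg : DependsOn g T) (hST : Disjoint S T) :
    IndepFun f g (edgeMeasure γ) := by
  obtain ⟨φ, hφ⟩ := exists_comp_restrict_of_dependsOn hf
  obtain ⟨ψ, hψ⟩ := exists_comp_restrict_of_dependsOn hg
  rw [funext hφ, funext hψ]
  exact ((iIndepFun_edgeMeasure γ).indepFun_finset S T hST fun e => measurable_pi_apply e).comp
    (measurable_of_finite φ) (measurable_of_finite ψ)

theorem measureReal_inter_eq_mul_of_dependsOn (γ : ℝ) {A B : Set (Sym2 ℤ → Bool)}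
    {S T : Finset (Sym2 ℤ)} (hA : DependsOn (· ∈ A) (S : Set (Sym2 ℤ)))
    (hB : DependsOn (· ∈ B) (T : Set (Sym2 ℤ)))
    (hST : Disjoint S T) :
    (edgeMeasure γ).real (A ∩ B) = (edgeMeasure γ).real A * (edgeMeasure γ).real B := by
  have h := (indepFun_of_dependsOn γ hA hB hST).measure_inter_preimage_eq_mul {True} {True}
    (measurableSet_singleton _) (measurableSet_singleton _)
  have h1 : (fun ω : Sym2 ℤ → Bool => ω ∈ A) ⁻¹' {True} = A := by ext; simp
  have h2 : (fun ω : Sym2 ℤ → Bool => ω ∈ B) ⁻¹' {True} = B := by ext; simp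
  rw [h1, h2] at h
  rw [measureReal_def, h, ENNReal.toReal_mul]
  rfl

/-- A sum of bounded variables that depend on disjoint finite sets of edges is sub-Gaussian. -/
theorem hasSubgaussianMGF_sum_of_dependsOn (γ : ℝ) {ι : Type*} (s : Finset ι)
    {X : ι → (Sym2 ℤ → Bool) → ℝ} {S : ι → Finset (Sym2 ℤ)}
    (hX : ∀ i ∈ s, DependsOn (X i) (S i : Set (Sym2 ℤ)))
    (hS : (s : Set ι).PairwiseDisjoint S) (hb : ∀ i ∈ s, ∀ ω, X i ω ∈ Icc (0 : ℝ) 1) :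
    HasSubgaussianMGF (fun ω => ∑ i ∈ s, (X i ω - ∫ ω', X i ω' ∂edgeMeasure γ)) (s.card * (1 / 4))
      (edgeMeasure γ) := by
  classical
  induction s using Finset.induction_on with
  | empty => simp
  | insert a s ha ih =>
    have ih := ih (fun i hi => hX i (Finset.mem_insert_of_mem hi))
      (hS.subset (by simp)) fun i hi => hb i (Finset.mem_insert_of_mem hi)
    have hXa := hX a (Finset.mem_insert_self _ _)
    have h1 : HasSubgaussianMGF (fun ω => X a ω - ∫ ω', X a ω' ∂edgeMeasure γ) (1 / 4)
        (edgeMeasure γ) := by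
      -- Hoeffding's lemma on [0, 1]: the variance proxy is (1/2)².
      have h := hasSubgaussianMGF_of_mem_Icc (μ := edgeMeasure γ)
        (measurable_of_dependsOn hXa).aemeasurable
        (Eventually.of_forall (hb a (Finset.mem_insert_self _ _)))
      convert h using 1
      rw [sub_zero, nnnorm_one]
      norm_num
    have h2 : IndepFun (fun ω => X a ω - ∫ ω', X a ω' ∂edgeMeasure γ)
        (fun ω => ∑ i ∈ s, (X i ω - ∫ ω', X i ω' ∂edgeMeasure γ)) (edgeMeasure γ) := by
      refine indepFun_of_dependsOn γ (S := S a) (T := s.biUnion S) ?_ ?_ ?_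
      · intro x y h
        simp only [hXa h]
      · intro x y h
        refine Finset.sum_congr rfl fun i hi => ?_
        rw [hX i (Finset.mem_insert_of_mem hi) fun e he => h e ?_]
        exact Finset.mem_coe.2 (Finset.mem_biUnion.2 ⟨i, hi, he⟩)
      · rw [Finset.disjoint_biUnion_right]
        intro i hi
        exact hS (by simp) (by simp [hi]) (by rintro rfl; exact ha hi)
    have h3 := h1.add_of_indepFun ih h2
    simp only [Finset.sum_insert ha, Finset.card_insert_of_notMem ha, Nat.cast_add, Nat.cast_one]
    rw [add_mul, one_mul, add_comm (_ * _)]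
    exact h3

theorem edgeMeasure_real_forall (γ : ℝ) (S : Finset (Sym2 ℤ)) :
    (edgeMeasure γ).real {ω | ∀ e ∈ S, ω e = true} =
      Real.exp (-∑ e ∈ S, (edgeLength e : ℝ) ^ γ) := by
  have : {ω : Sym2 ℤ → Bool | ∀ e ∈ S, ω e = true} = Set.pi (S : Set (Sym2 ℤ)) fun _ => {true} := by
    ext ω; simp [Set.mem_pi]
  rw [this, measureReal_def, edgeMeasure, Measure.infinitePi_pi _ fun _ _ => measurableSet_singleton _,
    ENNReal.toReal_prod, ← Finset.sum_neg_distrib, Real.exp_sum]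
  refine Finset.prod_congr rfl fun e _ => ?_
  rw [bernoulliMeasure_apply_of_mem_of_notMem _ (measurableSet_singleton _) (by simp) (by simp)]
  rfl

theorem edgeMeasure_open (γ : ℝ) (e : Sym2 ℤ) :
    edgeMeasure γ {ω | ω e = true} = ENNReal.ofReal (Real.exp (-(edgeLength e : ℝ) ^ γ)) := by
  have h := edgeMeasure_real_forall γ {e}
  simp only [Finset.mem_singleton, forall_eq, Finset.sum_singleton] at h
  rw [← h, measureReal_def, ENNReal.ofReal_toReal (measure_ne_top _ _)]

/-- Exponential Markov inequality for a weighted number of open edges. -/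
theorem edgeMeasure_real_le_sum_le (γ : ℝ) (F : Finset (Sym2 ℤ)) (w : Sym2 ℤ → ℝ) (a : ℝ) :
    (edgeMeasure γ).real {ω | a ≤ ∑ e ∈ F, if ω e = true then w e else 0} ≤
      Real.exp (-a + ∑ e ∈ F, Real.exp (w e - (edgeLength e : ℝ) ^ γ)) := by
  let X : Sym2 ℤ → (Sym2 ℤ → Bool) → ℝ := fun e ω => if ω e = true then w e else 0
  have hm : ∀ e, Measurable (X e) := fun e =>
    (measurable_of_finite fun b : Bool => if b = true then w e else 0).comp (measurable_pi_apply e)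
  have hindep : iIndepFun X (edgeMeasure γ) :=
    iIndepFun_infinitePi (X := fun e (b : Bool) => if b = true then w e else 0)
      fun e => measurable_of_finite _
  have hmgf : ∀ e, mgf (X e) (edgeMeasure γ) 1 ≤
      Real.exp (Real.exp (w e - (edgeLength e : ℝ) ^ γ)) := by
    intro e
    have h1 : mgf (X e) (edgeMeasure γ) 1 =
        ∫ b, Real.exp (if b = true then w e else 0) ∂(bernoulliMeasure true false (edgeProb γ e)) := by
      rw [← Measure.infinitePi_map_eval (fun e => bernoulliMeasure true false (edgeProb γ e)) e,
        integral_map (measurable_pi_apply e).aemeasurable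
          (measurable_of_finite _).aestronglyMeasurable]
      simp [mgf, X, edgeMeasure]
    rw [h1, integral_bernoulliMeasure]
    have h2 : ((edgeProb γ e : unitInterval) : ℝ) = Real.exp (-((edgeLength e : ℝ) ^ γ)) := rfl
    simp only [if_true, Bool.false_eq_true, if_false, Real.exp_zero, smul_eq_mul, mul_one, h2]
    -- With q the edge probability, the moment 1 - q + q e^w is at most 1 + q e^w.
    refine le_trans ?_ (Real.add_one_le_exp _)
    rw [sub_eq_add_neg (w e), Real.exp_add, mul_comm]
    have := Real.exp_pos (-((edgeLength e : ℝ) ^ γ))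
    linarith
  have hint : Integrable (fun ω => Real.exp (1 * (∑ e ∈ F, X e) ω)) (edgeMeasure γ) := by
    refine Integrable.of_bound (C := Real.exp (∑ e ∈ F, |w e|)) ?_ (Eventually.of_forall fun ω => ?_)
    · simp only [Finset.sum_apply]
      exact (Real.measurable_exp.comp
        ((Finset.measurable_sum F fun e _ => hm e).const_mul 1)).aestronglyMeasurable
    · rw [Real.norm_eq_abs, Real.abs_exp, one_mul, Finset.sum_apply]
      refine Real.exp_le_exp.2 (Finset.sum_le_sum fun e _ => ?_)
      simp only [X]
      split_ifs
      exacts [le_abs_self _, abs_nonneg _]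
  have h := measure_ge_le_exp_mul_mgf a zero_le_one hint
  rw [hindep.mgf_sum hm] at h
  rw [Real.exp_add]
  simp only [Finset.sum_apply, X, neg_mul, one_mul] at h
  refine h.trans (mul_le_mul_of_nonneg_left ?_ (Real.exp_pos _).le)
  rw [Real.exp_sum]
  exact Finset.prod_le_prod (fun e _ => mgf_nonneg) fun e _ => hmgf e

theorem summable_exp_neg_rpow {γ : ℝ} (hγ : 0 < γ) :
    Summable fun n : ℕ => Real.exp (-(n : ℝ) ^ γ) := by
  -- The power -2/γ of n^γ is n^(-2), which is summable.
  have h1 := (isLittleO_exp_neg_mul_rpow_atTop zero_lt_one (-2 / γ)).comp_tendsto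
    ((tendsto_rpow_atTop hγ).comp tendsto_natCast_atTop_atTop)
  refine summable_of_isBigO_nat (g := fun n : ℕ => (n : ℝ) ^ (-2 : ℝ))
    (Real.summable_nat_rpow.2 (by norm_num)) ?_
  refine (h1.isBigO.congr' ?_ ?_)
  · exact Eventually.of_forall fun n => by simp
  · refine Eventually.of_forall fun n => ?_
    simp only [Function.comp_apply]
    rw [← Real.rpow_mul (Nat.cast_nonneg n)]
    congr 1
    field_simp

theorem summable_int_exp_neg_rpow {γ : ℝ} (hγ : 0 < γ) (v : ℤ) :
    Summable fun y : ℤ => Real.exp (-((edgeLength s(v, y) : ℝ) ^ γ)) := by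
  have h : Summable fun y : ℤ => Real.exp (-(((|y| : ℤ) : ℝ) ^ γ)) := by
    refine Summable.of_nat_of_neg ?_ ?_
    · simpa using summable_exp_neg_rpow hγ
    · simpa using summable_exp_neg_rpow hγ
  exact (Equiv.subLeft v).summable_iff.2 h

/-- Borel–Cantelli at each vertex; besides the open edges there are only the two nearest-neighbour
edges. -/
theorem ae_isLocallyFinite {γ : ℝ} (hγ : 0 < γ) (V : Set ℤ) :
    ∀ᵐ ω ∂edgeMeasure γ, IsLocallyFinite (graphOf V ω) := by
  have h : ∀ v : ℤ, ∀ᵐ ω ∂edgeMeasure γ, {y | ω s(v, y) = true}.Finite := by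
    intro v
    refine ae_finite_setOfPred_mem (s := fun y => {ω : Sym2 ℤ → Bool | ω s(v, y) = true}) ?_
    simp only [edgeMeasure_open]
    exact (summable_int_exp_neg_rpow hγ v).tsum_ofReal_ne_top
  filter_upwards [ae_all_iff.2 h] with ω hω v _
  refine ((hω v).union (Set.toFinite {v - 1, v + 1})).subset fun y hy => ?_
  obtain ⟨-, -, -, h | h⟩ := hy
  · right
    rcases abs_eq (zero_le_one) |>.1 h with h | h
    · exact Or.inl (by omega)
    · exact Or.inr (by simp; omega)
  · exact Or.inl h

/-! ### Reference measures on graphs and translation invariance -/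

theorem measurableEmbedding_val : MeasurableEmbedding (Subtype.val : LFGraph → GraphOnZ) :=
  MeasurableEmbedding.subtype_coe measurableSet_isLocallyFinite

/-- Pulling back to locally finite graphs discards only a null set, so reference probabilities can
be computed on configurations. -/
theorem refMeasure_preimage (γ : ℝ) (V : Set ℤ)
    (hV : ∀ᵐ ω ∂edgeMeasure γ, IsLocallyFinite (graphOf V ω)) {A : Set GraphOnZ}
    (hA : MeasurableSet A) :
    refMeasure γ V (Subtype.val ⁻¹' A) = edgeMeasure γ {ω | graphOf V ω ∈ A} := by
  have himage : (Subtype.val : LFGraph → GraphOnZ) '' (Subtype.val ⁻¹' A) =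
      {g | IsLocallyFinite g} ∩ A := Subtype.image_preimage_coe _ _
  rw [refMeasure, measurableEmbedding_val.comap_apply, himage,
    Measure.map_apply (measurable_graphOf V) (measurableSet_isLocallyFinite.inter hA)]
  refine measure_congr ?_
  filter_upwards [hV] with ω hω
  refine propext ⟨fun h => h.2, fun h => ⟨hω, h⟩⟩

/-- The graph on `[N]` as a locally finite graph. -/
noncomputable def finiteGraph (N : ℕ) (ω : Sym2 ℤ → Bool) : LFGraph :=
  ⟨graphOf (segment N) ω, isLocallyFinite_graphOf_of_finite (Set.finite_Icc 1 (N : ℤ)) ω⟩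

theorem measurable_finiteGraph (N : ℕ) : Measurable (finiteGraph N) :=
  (measurable_graphOf (segment N)).subtype_mk

theorem finiteRef_eq_map (N : ℕ) (γ : ℝ) :
    finiteRef N γ = (edgeMeasure γ).map (finiteGraph N) := by
  ext s hs
  obtain ⟨A, hA, rfl⟩ := hs
  rw [Measure.map_apply (measurable_finiteGraph N) (measurable_subtype_coe hA), finiteRef,
    refMeasure_preimage γ _ (Eventually.of_forall fun ω => (finiteGraph N ω).2) hA]
  rfl

instance (γ : ℝ) (V : Set ℤ) : IsFiniteMeasure (refMeasure γ V) := by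
  refine ⟨?_⟩
  rw [refMeasure, measurableEmbedding_val.comap_apply]
  have : IsProbabilityMeasure ((edgeMeasure γ).map (graphOf V)) :=
    Measure.isProbabilityMeasure_map (measurable_graphOf V).aemeasurable
  exact measure_lt_top _ _

/-- The action of the translation by `a` on configurations. -/
def shiftConfig (a : ℤ) (ω : Sym2 ℤ → Bool) : Sym2 ℤ → Bool := fun e => ω (e.map (· + a))

/-- Edge probabilities depend only on the length, and the shift permutes the coordinates
injectively. -/
theorem map_shiftConfig (γ : ℝ) (a : ℤ) :
    (edgeMeasure γ).map (shiftConfig a) = edgeMeasure γ := by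
  have hinj : Function.Injective (Sym2.map (· + a)) := Sym2.map.injective (add_left_injective a)
  have h := Measure.map_infinitePi_infinitePi_of_inj
    (P := fun e => bernoulliMeasure true false (edgeProb γ e)) hinj
  have h2 : ∀ e : Sym2 ℤ, edgeProb γ (e.map (· + a)) = edgeProb γ e := by
    intro e
    induction e with
    | _ x y =>
      apply Subtype.ext
      simp [edgeProb, edgeLength]
  simp only [h2] at h
  exact h

theorem translate_graphOf_univ (a : ℤ) (ω : Sym2 ℤ → Bool) :
    translate a 0 (graphOf univ ω) = graphOf univ (shiftConfig a ω) := by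
  refine SimpleGraph.Subgraph.ext ?_ ?_
  · ext x
    rw [translate_verts]
    exact iff_of_true trivial trivial
  · ext x y
    rw [translate_adj]
    simp [graphOf, shiftConfig]

theorem edgeMeasure_rootedEq_ball_eq (γ : ℝ) (o o' : ℤ) (g' : GraphOnZ) {R : ℝ} (hR : 0 ≤ R) :
    edgeMeasure γ {ω | RootedEq (ball (graphOf univ ω) o R) o g' o'} =
      edgeMeasure γ {ω | RootedEq (ball (graphOf univ ω) 0 R) 0 g' o'} := by
  have hm : Measurable (shiftConfig o) := measurable_pi_lambda _ fun e => measurable_pi_apply _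
  conv_rhs => rw [← map_shiftConfig γ o]
  have hset : MeasurableSet {ω | RootedEq (ball (graphOf univ ω) 0 R) 0 g' o'} :=
    measurable_graphOf univ (measurableSet_rootedEq_ball 0 o' g' hR)
  rw [Measure.map_apply hm hset]
  congr 1
  ext ω
  rw [mem_preimage, Set.mem_ofPred_eq, Set.mem_ofPred_eq, ← translate_graphOf_univ,
    rootedEq_ball_translate _ _ _ _ _ hR]

/-! ### Long edges and the cuts they cross -/

/-- The pairs `(x, r)` such that `x` and `x + r` are in `[N]` and `r ≥ K`. -/
noncomputable def longPairs (N K : ℕ) : Finset (ℤ × ℕ) :=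
  (Finset.Icc (1 : ℤ) N ×ˢ Finset.Ico K N).filter fun q => q.1 + q.2 ≤ N

theorem mem_longPairs {N K : ℕ} {q : ℤ × ℕ} :
    q ∈ longPairs N K ↔ 1 ≤ q.1 ∧ K ≤ q.2 ∧ q.1 + q.2 ≤ N := by
  simp only [longPairs, Finset.mem_filter, Finset.mem_product, Finset.mem_Icc, Finset.mem_Ico]
  omega

/-- The pairs of vertices of `[N]` at distance at least `K`. -/
noncomputable def longEdges (N K : ℕ) : Finset (Sym2 ℤ) :=
  (longPairs N K).image fun q => s(q.1, q.1 + q.2)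

theorem mk_mem_longEdges {N K : ℕ} {x y : ℤ} :
    s(x, y) ∈ longEdges N K ↔ x ∈ segment N ∧ y ∈ segment N ∧ (K : ℤ) ≤ |x - y| := by
  simp only [longEdges, Finset.mem_image, mem_longPairs, segment, Set.mem_Icc, Prod.exists]
  constructor
  · rintro ⟨a, r, h, he⟩
    rcases Sym2.eq_iff.1 he with ⟨rfl, rfl⟩ | ⟨rfl, rfl⟩
    · rw [show a - (a + r) = -(r : ℤ) by ring, abs_neg, Nat.abs_cast]
      omega
    · rw [show a + r - a = (r : ℤ) by ring, Nat.abs_cast]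
      omega
  · rintro ⟨hx, hy, hK⟩
    rcases le_total x y with h | h
    · rw [abs_sub_comm, abs_of_nonneg (by omega)] at hK
      exact ⟨x, (y - x).toNat, by omega, by rw [Int.toNat_of_nonneg (by omega)]; congr 1; ring_nf⟩
    · rw [abs_of_nonneg (by omega)] at hK
      refine ⟨y, (x - y).toNat, by omega, ?_⟩
      rw [Int.toNat_of_nonneg (by omega), Sym2.eq_swap]; congr 1; ring_nf

@[simp]
theorem edgeLength_mk_add (x : ℤ) (r : ℕ) : edgeLength s(x, x + r) = r := by
  simp [edgeLength]

theorem injOn_longPairs (N : ℕ) {K : ℕ} :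
    Set.InjOn (fun q : ℤ × ℕ => s(q.1, q.1 + q.2)) (longPairs N K) := by
  rintro ⟨x, r⟩ h ⟨y, s⟩ h' he
  rw [Finset.mem_coe, mem_longPairs] at h h'
  rcases Sym2.eq_iff.1 he with ⟨h1, h2⟩ | ⟨h1, h2⟩ <;> simp only [Prod.mk.injEq] at * <;> omega

theorem sum_longEdges {N K : ℕ} (f : Sym2 ℤ → ℝ) :
    ∑ e ∈ longEdges N K, f e = ∑ q ∈ longPairs N K, f s(q.1, q.1 + q.2) :=
  Finset.sum_image (injOn_longPairs N)

theorem sum_longEdges_le {N K : ℕ} {f : Sym2 ℤ → ℝ} {h : ℕ → ℝ} (h0 : ∀ r, 0 ≤ h r)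
    (hf : ∀ x (r : ℕ), f s(x, x + r) = h r) :
    ∑ e ∈ longEdges N K, f e ≤ N * ∑ r ∈ Finset.Ico K N, h r := by
  rw [sum_longEdges]
  simp only [hf]
  refine (Finset.sum_le_sum_of_subset_of_nonneg (Finset.filter_subset _ _)
    fun q _ _ => h0 q.2).trans ?_
  rw [Finset.sum_product]
  simp

/-- The total length of the open edges of length at least `K`. -/
noncomputable def openLength (N K : ℕ) (ω : Sym2 ℤ → Bool) : ℝ :=
  ∑ e ∈ longEdges N K, if ω e = true then (edgeLength e : ℝ) else 0

/-- Since `2 ≤ K`, the edges counted on the left are not nearest-neighbour edges, so each of them is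
open in `ω`. -/
theorem encard_crossing_graphOf_le (N K : ℕ) (hK : 2 ≤ K) (ω : Sym2 ℤ → Bool) (v : ℤ) :
    (crossing (graphOf (segment N) ω).spanningCoe K v).encard ≤
      ((longPairs N K).filter fun q =>
        ω s(q.1, q.1 + q.2) = true ∧ q.1 ≤ v ∧ v < q.1 + q.2).card := by
  classical
  set B := (longPairs N K).filter fun q =>
        ω s(q.1, q.1 + q.2) = true ∧ q.1 ≤ v ∧ v < q.1 + q.2 with hB
  have hsub : crossing (graphOf (segment N) ω).spanningCoe K v ⊆
      ((B.image fun q => (q.1, q.1 + (q.2 : ℤ))) : Finset (ℤ × ℤ)) := by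
    rintro ⟨x, y⟩ ⟨⟨hx, hy, hxy, h⟩, h1, h2, h3⟩
    simp only [segment, Set.mem_Icc] at hx hy h1 h2 h3 h
    have hxy' : ω s(x, y) = true := by
      rcases h with h | h
      · rw [abs_sub_comm, abs_of_nonneg (by omega)] at h
        omega
      · exact h
    refine Finset.mem_coe.2 (Finset.mem_image.2 ⟨(x, (y - x).toNat), ?_, ?_⟩)
    · rw [hB, Finset.mem_filter, mem_longPairs]
      dsimp only
      rw [Int.toNat_of_nonneg (by omega), add_sub_cancel]
      exact ⟨by omega, hxy', by omega, by omega⟩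
    · dsimp only
      rw [Int.toNat_of_nonneg (by omega), add_sub_cancel]
  refine (Set.encard_le_encard hsub).trans ?_
  rw [Set.encard_coe_eq_coe_finsetCard]
  exact_mod_cast Finset.card_image_le

/-- If the total length of the long edges is below `(k - η) N`, then a positive fraction of the
gaps are crossed by fewer than `k` long edges. -/
theorem exists_crossing_le {N K k : ℕ} (hK : 2 ≤ K) (hk : 1 ≤ k) {η : ℝ} {ω : Sym2 ℤ → Bool}
    (h : openLength N K ω < (k - η) * N) :
    ∃ A ⊆ Finset.Icc (1 : ℤ) N, η * N / k ≤ A.card ∧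
      ∀ v ∈ A, (crossing (graphOf (segment N) ω).spanningCoe K v).encard ≤ (k - 1 : ℕ) := by
  classical
  let c : ℤ → ℕ := fun v => ((longPairs N K).filter fun q =>
        ω s(q.1, q.1 + q.2) = true ∧ q.1 ≤ v ∧ v < q.1 + q.2).card
  refine ⟨(Finset.Icc (1 : ℤ) N).filter fun v => c v ≤ k - 1, Finset.filter_subset _ _, ?_, ?_⟩
  swap
  · intro v hv
    refine (encard_crossing_graphOf_le N K hK ω v).trans ?_
    exact_mod_cast (Finset.mem_filter.1 hv).2
  -- Double counting: an edge of length r crosses exactly r gaps.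
  have hsum : openLength N K ω = ∑ v ∈ Finset.Icc (1 : ℤ) N, (c v : ℝ) := by
    have h1 : ∀ v, (c v : ℝ) = ∑ q ∈ longPairs N K,
        if ω s(q.1, q.1 + q.2) = true ∧ q.1 ≤ v ∧ v < q.1 + q.2 then (1 : ℝ) else 0 := by
      intro v
      rw [Finset.sum_boole]
    simp only [h1]
    rw [Finset.sum_comm, openLength, sum_longEdges]
    refine Finset.sum_congr rfl fun q hq => ?_
    rw [mem_longPairs] at hq
    split_ifs with hω
    · simp only [hω, true_and]
      rw [Finset.sum_boole, edgeLength_mk_add]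
      have : (Finset.Icc (1 : ℤ) N).filter (fun v => q.1 ≤ v ∧ v < q.1 + q.2) =
          Finset.Ico q.1 (q.1 + q.2) := by
        ext v
        simp only [Finset.mem_filter, Finset.mem_Icc, Finset.mem_Ico]
        omega
      rw [this, Int.card_Ico]
      simp
    · simp [hω]
  set A := (Finset.Icc (1 : ℤ) N).filter fun v => c v ≤ k - 1 with hA
  have hcard : ((Finset.Icc (1 : ℤ) N \ A).card : ℝ) = N - A.card := by
    rw [Finset.card_sdiff_of_subset (Finset.filter_subset _ _), Nat.cast_sub
      (Finset.card_le_card (Finset.filter_subset _ _)), Int.card_Icc]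
    simp [hA]
  -- Every gap outside `A` is crossed by at least k long open edges.
  have hle : (k : ℝ) * (N - A.card) ≤ openLength N K ω := by
    rw [hsum, ← hcard, mul_comm, ← nsmul_eq_mul]
    refine (Finset.card_nsmul_le_sum _ (fun v => (c v : ℝ)) _ ?_).trans
      (Finset.sum_le_sum_of_subset_of_nonneg Finset.sdiff_subset fun v _ _ => Nat.cast_nonneg _)
    intro v hv
    simp only [hA, Finset.mem_sdiff, Finset.mem_filter, not_and, not_le] at hv
    have := hv.2 hv.1
    exact_mod_cast (by omega : k ≤ c v)
  have hk' : (0 : ℝ) < k := by exact_mod_cast hk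
  rw [div_le_iff₀ hk']
  nlinarith

/-! ### Energy and distances -/

/-- The pairs `x < y` of vertices of `[N]`. -/
noncomputable def orderedPairs (N : ℕ) : Finset (ℤ × ℤ) :=
  (Finset.Icc (1 : ℤ) N ×ˢ Finset.Icc (1 : ℤ) N).filter fun q => q.1 < q.2

theorem card_orderedPairs (N : ℕ) : (orderedPairs N).card = N.choose 2 := by
  classical
  have h1 : (Finset.Icc (1 : ℤ) N).offDiag = orderedPairs N ∪ (orderedPairs N).image Prod.swap := by
    ext ⟨x, y⟩
    simp only [Finset.mem_offDiag, orderedPairs, Finset.mem_union, Finset.mem_filter,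
      Finset.mem_product, Finset.mem_image, Prod.exists, Prod.swap, Prod.mk.injEq]
    constructor
    · rintro ⟨hx, hy, hne⟩
      rcases lt_or_gt_of_ne hne with h | h
      · exact Or.inl ⟨⟨hx, hy⟩, h⟩
      · exact Or.inr ⟨y, x, ⟨⟨hy, hx⟩, h⟩, rfl, rfl⟩
    · rintro (⟨⟨hx, hy⟩, h⟩ | ⟨a, b, ⟨⟨hx, hy⟩, h⟩, rfl, rfl⟩)
      · exact ⟨hx, hy, h.ne⟩
      · exact ⟨hy, hx, h.ne'⟩
  have h2 : Disjoint (orderedPairs N) ((orderedPairs N).image Prod.swap) := by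
    rw [Finset.disjoint_left]
    rintro ⟨x, y⟩ h h'
    obtain ⟨⟨a, b⟩, hab, he⟩ := Finset.mem_image.1 h'
    simp only [orderedPairs, Finset.mem_filter, Prod.swap, Prod.mk.injEq] at h hab he
    omega
  have h3 := congrArg Finset.card h1
  rw [Finset.card_union_of_disjoint h2, Finset.card_image_of_injective _ Prod.swap_injective,
    Finset.offDiag_card, Int.card_Icc] at h3
  rw [Nat.choose_two_right, Nat.mul_sub_one]
  simp at h3
  omega

theorem tsum_orderedPairs (N : ℕ) {g : GraphOnZ} (hg : g.verts = segment N)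
    (f : ℤ × ℤ → ℝ≥0∞) :
    ∑' q : {q : ℤ × ℤ // q.1 ∈ g.verts ∧ q.2 ∈ g.verts ∧ q.1 < q.2}, f q.1 =
      ∑ q ∈ orderedPairs N, f q := by
  rw [← Finset.tsum_subtype]
  have : {q : ℤ × ℤ | q.1 ∈ g.verts ∧ q.2 ∈ g.verts ∧ q.1 < q.2} = {q | q ∈ orderedPairs N} := by
    ext q
    simp [orderedPairs, hg, segment, and_assoc]
  exact tsum_congr_set_coe f this

theorem energy_of_ne_top {p : ℝ≥0∞} (hp : p ≠ ∞) {N : ℕ} {g : GraphOnZ}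
    (hg : g.verts = segment N) :
    energy p g = (((N.choose 2 : ℕ) : ℝ≥0∞)⁻¹ *
      ∑ q ∈ orderedPairs N, gdist g q.1 q.2 ^ p.toReal) ^ (1 / p.toReal) := by
  rw [energy, if_neg hp, tsum_orderedPairs N hg fun q => gdist g q.1 q.2 ^ p.toReal, hg]
  congr 5
  rw [segment, ← Finset.coe_Icc, Set.ncard_coe_finset, Int.card_Icc]
  simp

theorem energy_le_of_forall_within {p : ℝ≥0∞} (hp : 1 ≤ p) {N : ℕ} {g : GraphOnZ}
    (hg : g.verts = segment N) {n : ℕ}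
    (h : ∀ x ∈ segment N, ∀ y ∈ segment N, Within g n x y) : energy p g ≤ n := by
  by_cases hp' : p = ∞
  · rw [energy, if_pos hp', hg]
    exact iSup₂_le fun x hx => iSup₂_le fun y hy => gdist_le_natCast_iff.2 (h x hx y hy)
  have hpos : 0 < p.toReal := ENNReal.toReal_pos (zero_lt_one.trans_le hp).ne' hp'
  rw [energy_of_ne_top hp' hg]
  have h1 : ∑ q ∈ orderedPairs N, gdist g q.1 q.2 ^ p.toReal ≤
      (N.choose 2 : ℕ) * (n : ℝ≥0∞) ^ p.toReal := by
    rw [← card_orderedPairs, ← nsmul_eq_mul]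
    refine Finset.sum_le_card_nsmul _ _ _ fun q hq => ?_
    simp only [orderedPairs, Finset.mem_filter, Finset.mem_product, Finset.mem_Icc] at hq
    exact ENNReal.rpow_le_rpow (gdist_le_natCast_iff.2 (h _ hq.1.1 _ hq.1.2)) hpos.le
  calc _ ≤ ((n : ℝ≥0∞) ^ p.toReal) ^ (1 / p.toReal) := by
        refine ENNReal.rpow_le_rpow ?_ (by positivity)
        refine (mul_le_mul_right h1 _).trans ?_
        rw [← mul_assoc]
        exact mul_le_of_le_one_left' (ENNReal.inv_mul_le_one _)
    _ = n := by rw [← ENNReal.rpow_mul, mul_one_div_cancel hpos.ne', ENNReal.rpow_one]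

open Classical in
/-- Markov's inequality for the distances. -/
theorem card_not_within_le {p : ℝ≥0∞} (hp : 1 ≤ p) {N : ℕ} {g : GraphOnZ}
    (hg : g.verts = segment N) {h : ℝ} {t : ℕ} (ht : 0 < t) (h0 : 0 ≤ h) (hht : h ≤ t)
    (hE : energy p g ≤ ENNReal.ofReal h) :
    (((orderedPairs N).filter fun q => ¬ Within g t q.1 q.2).card : ℝ) ≤ h / t * N.choose 2 := by
  have ht' : (0 : ℝ) < t := by exact_mod_cast ht
  by_cases hp' : p = ∞
  · rw [energy, if_pos hp', hg] at hE
    have : (orderedPairs N).filter (fun q => ¬ Within g t q.1 q.2) = ∅ := by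
      refine Finset.filter_eq_empty_iff.2 fun q hq => not_not.2 (gdist_le_natCast_iff.1 ?_)
      simp only [orderedPairs, Finset.mem_filter, Finset.mem_product, Finset.mem_Icc] at hq
      refine (le_iSup₂_of_le (f := fun x _ => ⨆ y ∈ segment N, gdist g x y) q.1 hq.1.1
        (le_iSup₂_of_le (f := fun y _ => gdist g q.1 y) q.2 hq.1.2 le_rfl)).trans (hE.trans ?_)
      rw [← ENNReal.ofReal_natCast]
      exact ENNReal.ofReal_le_ofReal hht
    rw [this]
    simp only [Finset.card_empty, Nat.cast_zero]
    positivity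
  have hp1 : 1 ≤ p.toReal := by
    simpa using ENNReal.toReal_mono hp' hp
  have hpos : 0 < p.toReal := by linarith
  set B := (orderedPairs N).filter fun q => ¬ Within g t q.1 q.2 with hB
  rcases Nat.eq_zero_or_pos (N.choose 2) with hN | hN
  · have : orderedPairs N = ∅ := Finset.card_eq_zero.1 ((card_orderedPairs N).trans hN)
    simp [hB, this, hN]
  have hN0 : ((N.choose 2 : ℕ) : ℝ≥0∞) ≠ 0 := by exact_mod_cast hN.ne'
  rw [energy_of_ne_top hp' hg, one_div, ENNReal.rpow_inv_le_iff hpos,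
    ENNReal.inv_mul_le_iff hN0 (ENNReal.natCast_ne_top _)] at hE
  have h1 : (B.card : ℝ≥0∞) * ENNReal.ofReal t ^ p.toReal ≤
      ∑ q ∈ orderedPairs N, gdist g q.1 q.2 ^ p.toReal := by
    rw [← nsmul_eq_mul]
    refine (Finset.card_nsmul_le_sum B (fun q => gdist g q.1 q.2 ^ p.toReal) _ fun q hq => ?_).trans
      (Finset.sum_le_sum_of_subset (Finset.filter_subset _ _))
    refine ENNReal.rpow_le_rpow ?_ hpos.le
    have := (Finset.mem_filter.1 hq).2
    rw [← gdist_le_natCast_iff, not_le] at this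
    rw [ENNReal.ofReal_natCast]
    exact this.le
  have h2 := h1.trans hE
  rw [ENNReal.ofReal_rpow_of_nonneg ht'.le hpos.le, ENNReal.ofReal_rpow_of_nonneg h0 hpos.le,
    ← ENNReal.ofReal_natCast, ← ENNReal.ofReal_natCast, ← ENNReal.ofReal_mul (by positivity),
    ← ENNReal.ofReal_mul (by positivity), ENNReal.ofReal_le_ofReal_iff (by positivity)] at h2
  have h3 : (B.card : ℝ) ≤ N.choose 2 * (h / t) ^ p.toReal := by
    rw [Real.div_rpow h0 ht'.le, mul_div_assoc', le_div_iff₀ (by positivity)]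
    exact h2
  refine h3.trans ?_
  rw [mul_comm]
  refine mul_le_mul_of_nonneg_right ?_ (by positivity)
  -- Markov for the p-th power gives (h/t)^p; since h ≤ t and p ≥ 1 this is at most h/t, a bound
  -- uniform in p.
  calc (h / t) ^ p.toReal ≤ (h / t) ^ (1 : ℝ) :=
        Real.rpow_le_rpow_of_exponent_ge' (by positivity) ((div_le_one ht').2 hht) zero_le_one hp1
    _ = h / t := Real.rpow_one _

open Classical in
-- Some vertex does no worse than average: each far pair is counted from both of its ends, and 2 ·
-- (N choose 2) ≤ N².
theorem exists_card_not_within_le {p : ℝ≥0∞} (hp : 1 ≤ p) {N : ℕ} (hN : 0 < N) {g : GraphOnZ}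
    (hg : g.verts = segment N) {h : ℝ} {t : ℕ} (ht : 0 < t) (h0 : 0 ≤ h) (hht : h ≤ t)
    (hE : energy p g ≤ ENNReal.ofReal h) :
    ∃ o ∈ Finset.Icc (1 : ℤ) N,
      (((Finset.Icc (1 : ℤ) N).filter fun y => ¬ Within g t o y).card : ℝ) ≤ h / t * N := by
  have hne : (Finset.Icc (1 : ℤ) N).Nonempty := ⟨1, by simp; omega⟩
  refine Finset.exists_le_of_sum_le hne ?_
  have h1 := card_not_within_le hp hg ht h0 hht hE
  set B := (orderedPairs N).filter fun q => ¬ Within g t q.1 q.2 with hB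
  have h2 : ∑ o ∈ Finset.Icc (1 : ℤ) N,
      (((Finset.Icc (1 : ℤ) N).filter fun y => ¬ Within g t o y).card : ℝ) ≤ 2 * B.card := by
    have h3 : ∑ o ∈ Finset.Icc (1 : ℤ) N,
        ((Finset.Icc (1 : ℤ) N).filter fun y => ¬ Within g t o y).card =
        ((Finset.Icc (1 : ℤ) N ×ˢ Finset.Icc (1 : ℤ) N).filter
          fun q => ¬ Within g t q.1 q.2).card := by
      simp only [Finset.card_filter]
      rw [Finset.sum_product]
    have h4 : (Finset.Icc (1 : ℤ) N ×ˢ Finset.Icc (1 : ℤ) N).filter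
          (fun q => ¬ Within g t q.1 q.2) ⊆ B ∪ B.image Prod.swap := by
      rintro ⟨x, y⟩ hxy
      simp only [Finset.mem_filter, Finset.mem_product] at hxy
      rcases lt_trichotomy x y with h | rfl | h
      · exact Finset.mem_union_left _ (by
          simp only [hB, orderedPairs, Finset.mem_filter, Finset.mem_product]
          exact ⟨⟨hxy.1, h⟩, hxy.2⟩)
      · exact absurd (within_self _ _ _) hxy.2
      · refine Finset.mem_union_right _ (Finset.mem_image.2 ⟨(y, x), ?_, rfl⟩)
        simp only [hB, orderedPairs, Finset.mem_filter, Finset.mem_product]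
        exact ⟨⟨⟨hxy.1.2, hxy.1.1⟩, h⟩, fun h' => hxy.2 h'.symm⟩
    have h5 := (Finset.card_le_card h4).trans (Finset.card_union_le _ _)
    rw [← h3] at h5
    have h6 := Finset.card_image_le (s := B) (f := Prod.swap)
    exact_mod_cast (by omega)
  refine h2.trans ?_
  rw [Finset.sum_const, Int.card_Icc, nsmul_eq_mul]
  have h7 : (2 * N.choose 2 : ℝ) ≤ N * N := by
    have : 2 * N.choose 2 ≤ N * N := by
      rw [Nat.choose_two_right]
      have := Nat.mul_div_le (N * (N - 1)) 2
      nlinarith [Nat.sub_le N 1]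
    exact_mod_cast this
  have h8 : 0 ≤ h / t := by positivity
  simp only [add_sub_cancel_right, Int.toNat_natCast]
  nlinarith

/-- The lower bound on the total length of the long edges of a graph with small energy. -/
theorem lower_bound_of_energy_le {p : ℝ≥0∞} (hp : 1 ≤ p) {N K k t : ℕ} (hN : 0 < N) (hK : 2 ≤ K)
    (hk : 1 ≤ k) (ht : 0 < t) {η h : ℝ} (h0 : 0 ≤ h) (hht : h ≤ t) {ω : Sym2 ℤ → Bool}
    (hE : energy p (graphOf (segment N) ω) ≤ ENNReal.ofReal h)
    (hL : openLength N K ω < (k - η) * N) :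
    η * N / k ≤ h / t * N + K * (4 * t : ℝ) ^ k := by
  classical
  obtain ⟨A, hAN, hA, hcr⟩ := exists_crossing_le hK hk hL
  obtain ⟨o, ho, hoc⟩ := exists_card_not_within_le hp hN (g := graphOf (segment N) ω) rfl ht h0 hht hE
  set g := graphOf (segment N) ω
  -- `A` holds at least ηN/k thin cuts. Those far from o are few by Markov; those within t of o are
  -- connected in a tree whose paths have length at most 2t, hence are few by the cut lemma.
  obtain ⟨T, hTg, hTp, hTr⟩ := exists_le_forall_path_length_le g.spanningCoe o t
  have h1 : A.card ≤ (A.filter fun y => Within g t o y).card +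
      ((Finset.Icc (1 : ℤ) N).filter fun y => ¬ Within g t o y).card := by
    rw [← Finset.card_filter_add_card_filter_not (s := A) fun y => Within g t o y]
    gcongr
  have hreach : ∀ v, Within g t o v → T.Reachable o v := by
    rintro v ⟨q, hq⟩
    exact hTr v q.reachable ((SimpleGraph.dist_le q).trans hq)
  have h2 : (A.filter fun y => Within g t o y).card ≤ (2 * t * K + 1) * (2 * t + 2) ^ (k - 1) := by
    refine card_le_of_crossing_le (2 * t) K (k - 1) T hTp _ ?_ ?_
    · intro u hu v hv
      exact (hreach u (Finset.mem_filter.1 hu).2).symm.trans (hreach v (Finset.mem_filter.1 hv).2)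
    · intro v hv
      exact (Set.encard_le_encard (crossing_mono hTg K v)).trans (hcr v (Finset.mem_filter.1 hv).1)
  have h3 : (2 * t * K + 1) * (2 * t + 2) ^ (k - 1) ≤ K * (4 * t) ^ k := by
    obtain ⟨k, rfl⟩ := Nat.exists_eq_add_of_le' hk
    rw [Nat.add_sub_cancel, pow_succ']
    calc (2 * t * K + 1) * (2 * t + 2) ^ k ≤ (K * (4 * t)) * (4 * t) ^ k := by
          gcongr
          · nlinarith
          · omega
      _ = _ := by ring
  have h4 : (A.card : ℝ) ≤ K * (4 * t : ℝ) ^ k +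
      (((Finset.Icc (1 : ℤ) N).filter fun y => ¬ Within g t o y).card : ℝ) := by
    exact_mod_cast h1.trans (by gcongr; exact h2.trans h3)
  linarith

/-! ### Hierarchies of layers and the lower bound on the normalizing constant -/

theorem dependsOn_graphOf_segment (N : ℕ) :
    DependsOn (graphOf (segment N)) (longEdges N 1 : Set (Sym2 ℤ)) := by
  intro ω ω' h
  refine SimpleGraph.Subgraph.ext rfl ?_
  ext x y
  refine and_congr_right fun hx => and_congr_right fun hy => and_congr_right fun hxy => ?_
  rw [h s(x, y)]
  refine Finset.mem_coe.2 (mk_mem_longEdges.2 ⟨hx, hy, ?_⟩)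
  have := abs_pos.2 (sub_ne_zero.2 hxy)
  omega

/-- The Hamiltonian `N ^ b ℋ_p` of a configuration. -/
noncomputable def hamiltonian (N : ℕ) (b : ℝ) (p : ℝ≥0∞) (ω : Sym2 ℤ → Bool) : ℝ :=
  (N : ℝ) ^ b * (energy p (graphOf (segment N) ω)).toReal

theorem dependsOn_hamiltonian (N : ℕ) (b : ℝ) (p : ℝ≥0∞) :
    DependsOn (hamiltonian N b p) (longEdges N 1 : Set (Sym2 ℤ)) := fun ω ω' h => by
  rw [hamiltonian, hamiltonian, dependsOn_graphOf_segment N h]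

theorem hamiltonian_nonneg (N : ℕ) (b : ℝ) (p : ℝ≥0∞) (ω : Sym2 ℤ → Bool) :
    0 ≤ hamiltonian N b p ω := by
  unfold hamiltonian; positivity

theorem integrable_exp_neg_hamiltonian (N : ℕ) (γ b : ℝ) (p : ℝ≥0∞) :
    Integrable (fun ω => Real.exp (-hamiltonian N b p ω)) (edgeMeasure γ) := by
  refine Integrable.of_bound (C := 1) ?_ (Eventually.of_forall fun ω => ?_)
  · exact (Real.measurable_exp.comp
      (measurable_of_dependsOn (dependsOn_hamiltonian N b p)).neg).aestronglyMeasurable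
  · rw [Real.norm_eq_abs, Real.abs_exp, Real.exp_le_one_iff]
    exact neg_nonpos.2 (hamiltonian_nonneg N b p ω)

/-- The normalizing constant. -/
noncomputable def partitionFunction (N : ℕ) (γ b : ℝ) (p : ℝ≥0∞) : ℝ :=
  ∫ ω, Real.exp (-hamiltonian N b p ω) ∂edgeMeasure γ

/-- The pairs indexing the edges of a hierarchy of layers with ratio `L`. -/
noncomputable def layerIndex (N M L : ℕ) : Finset (ℕ × ℕ) :=
  (Finset.Icc 1 M ×ˢ Finset.range N).filter fun q => (q.2 + 1) * L ^ q.1 < N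

/-- A hierarchy of `M` layers of edges: the layer `j` joins consecutive points of `1 + L ^ j ℕ`. -/
noncomputable def layerEdges (N M L : ℕ) : Finset (Sym2 ℤ) :=
  (layerIndex N M L).image fun q =>
    s(1 + (q.2 * L ^ q.1 : ℕ), 1 + (q.2 * L ^ q.1 : ℕ) + (L ^ q.1 : ℕ))

theorem within_one_of_adj {g : GraphOnZ} {x y : ℤ} (h : g.Adj x y) : Within g 1 x y :=
  within_succ_iff.2 (Or.inr ⟨x, within_self g 0 x, h⟩)

theorem within_layer {N M L : ℕ} (hL : 1 ≤ L) {ω : Sym2 ℤ → Bool}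
    (hω : ∀ e ∈ layerEdges N M L, ω e = true) {j : ℕ} (hj : j ≤ M) (i s : ℕ)
    (h : (i + s) * L ^ j < N) :
    Within (graphOf (segment N) ω) s (1 + (i * L ^ j : ℕ)) (1 + ((i + s) * L ^ j : ℕ)) := by
  have hLj : 1 ≤ L ^ j := Nat.one_le_pow _ _ hL
  induction s with
  | zero => exact within_self _ _ _
  | succ s ih =>
    have hlt : (i + s) * L ^ j < N := lt_of_le_of_lt (by gcongr; omega) h
    have heq : (i + (s + 1)) * L ^ j = (i + s) * L ^ j + L ^ j := by ring
    refine (ih hlt).trans (within_one_of_adj ⟨?_, ?_, ?_, ?_⟩)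
    · exact ⟨by omega, by omega⟩
    · exact ⟨by omega, by omega⟩
    · rw [heq]; push_cast; have : (0 : ℤ) < (L : ℤ) ^ j := by positivity
      linarith
    · rcases Nat.eq_zero_or_pos j with rfl | hj0
      · left
        simp only [pow_zero, mul_one]
        push_cast
        rw [show (1 + ((i : ℤ) + s) - (1 + (i + (s + 1)))) = -1 by ring]
        rfl
      · right
        refine hω _ (Finset.mem_image.2 ⟨(j, i + s), ?_, ?_⟩)
        · simp only [layerIndex, Finset.mem_filter, Finset.mem_product, Finset.mem_Icc,
            Finset.mem_range]
          refine ⟨⟨⟨hj0, hj⟩, ?_⟩, ?_⟩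
          · exact lt_of_le_of_lt (Nat.le_mul_of_pos_right _ hLj) hlt
          · show (i + s + 1) * L ^ j < N
            rwa [add_assoc]
        · dsimp only
          rw [heq]
          push_cast
          congr 1
          ring_nf

/-- Expansion in base L: to pass from a rounded down to a multiple of L^(j+1) to a rounded down to a
multiple of L^j, fewer than L steps in the layer j suffice. The layer 0 consists of the
nearest-neighbour edges, which are always present. -/
theorem within_hierarchy {N M L : ℕ} (hL : 1 ≤ L) {ω : Sym2 ℤ → Bool}
    (hω : ∀ e ∈ layerEdges N M L, ω e = true) {a : ℕ} (ha : a < N) {j : ℕ} (hj : j ≤ M + 1) :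
    Within (graphOf (segment N) ω) (j * L) (1 + (a / L ^ j * L ^ j : ℕ)) (1 + (a : ℕ)) := by
  induction j with
  | zero => simpa using within_self _ _ _
  | succ j ih =>
    have hq : a / L ^ (j + 1) * L ^ (j + 1) = a / L ^ j / L * L * L ^ j := by
      rw [pow_succ, Nat.div_div_eq_div_mul]; ring
    have h1 : a / L ^ j / L * L + a / L ^ j % L = a / L ^ j := Nat.div_add_mod' _ _
    have h2 : a / L ^ j * L ^ j ≤ a := Nat.div_mul_le_self _ _
    have h := within_layer hL hω (j := j) (by omega) (a / L ^ j / L * L) (a / L ^ j % L)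
      (by rw [h1]; omega)
    rw [h1, ← hq] at h
    refine (h.trans (ih (by omega))).mono ?_
    have := (Nat.mod_lt (a / L ^ j) hL).le
    rw [add_mul]
    omega

theorem within_of_layerEdges {N M L : ℕ} (hL : 1 ≤ L) (hN : N ≤ L ^ (M + 1)) {ω : Sym2 ℤ → Bool}
    (hω : ∀ e ∈ layerEdges N M L, ω e = true) :
    ∀ x ∈ segment N, ∀ y ∈ segment N,
      Within (graphOf (segment N) ω) (2 * ((M + 1) * L)) x y := by
  have h : ∀ x ∈ segment N, Within (graphOf (segment N) ω) ((M + 1) * L) 1 x := by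
    rintro x ⟨hx1, hx2⟩
    have h := within_hierarchy hL hω (a := (x - 1).toNat) (by omega) le_rfl
    rw [Nat.div_eq_of_lt (by omega), zero_mul, Nat.cast_zero, add_zero,
      show (1 : ℤ) + ((x - 1).toNat : ℕ) = x by omega] at h
    exact h
  intro x hx y hy
  rw [two_mul]
  exact (h x hx).symm.trans (h y hy)

/-- The layer j has at most N / L^j edges, each of cost L^(jγ). For γ ≤ 1 the total N L^(j(γ-1)) is
largest at j = 1. -/
theorem sum_layerEdges_le {N M L : ℕ} (hL : 1 ≤ L) {γ : ℝ} (hγ : M = 0 ∨ γ ≤ 1) :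
    ∑ e ∈ layerEdges N M L, (edgeLength e : ℝ) ^ γ ≤ M * (N * (L : ℝ) ^ (γ - 1)) := by
  have hL0 : (0 : ℝ) < L := by exact_mod_cast hL
  have hL1 : (1 : ℝ) ≤ L := by exact_mod_cast hL
  have h1 : ∑ e ∈ layerEdges N M L, (edgeLength e : ℝ) ^ γ ≤
      ∑ q ∈ layerIndex N M L, ((L : ℝ) ^ q.1) ^ γ := by
    -- The indexing of the edges need not be injective (for L = 1 all layers coincide), so each edge
    -- is bounded by the sum over its fibre.
    have h2 : ∀ e ∈ layerEdges N M L, (edgeLength e : ℝ) ^ γ ≤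
        ∑ q ∈ (layerIndex N M L).filter (fun q =>
          s((1 + (q.2 * L ^ q.1 : ℕ) : ℤ), 1 + (q.2 * L ^ q.1 : ℕ) + (L ^ q.1 : ℕ)) = e),
          ((L : ℝ) ^ q.1) ^ γ := by
      intro e he
      obtain ⟨q, hq, rfl⟩ := Finset.mem_image.1 he
      refine le_trans (le_of_eq ?_) (Finset.single_le_sum (f := fun q : ℕ × ℕ => ((L : ℝ) ^ q.1) ^ γ)
        (fun q _ => by positivity) (Finset.mem_filter.2 ⟨hq, rfl⟩))
      rw [edgeLength_mk_add]
      push_cast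
      rfl
    refine (Finset.sum_le_sum h2).trans (le_of_eq ?_)
    exact Finset.sum_fiberwise_of_maps_to (fun q hq => Finset.mem_image_of_mem _ hq) _
  refine h1.trans ?_
  rw [layerIndex, Finset.sum_filter, Finset.sum_product]
  rw [show (M : ℝ) * (N * (L : ℝ) ^ (γ - 1)) = ∑ j ∈ Finset.Icc 1 M, N * (L : ℝ) ^ (γ - 1) by simp]
  refine Finset.sum_le_sum fun j hj => ?_
  have hj := Finset.mem_Icc.1 hj
  have hγ : γ ≤ 1 := hγ.resolve_left (by omega)
  rw [← Finset.sum_filter]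
  dsimp only
  rw [Finset.sum_const, nsmul_eq_mul]
  have hc : (((Finset.range N).filter fun i => (i + 1) * L ^ j < N).card : ℝ) ≤ N / (L : ℝ) ^ j := by
    have : (Finset.range N).filter (fun i => (i + 1) * L ^ j < N) ⊆ Finset.range (N / L ^ j) := by
      intro i hi
      rw [Finset.mem_range]
      have := (Finset.mem_filter.1 hi).2
      exact (Nat.le_div_iff_mul_le (by positivity)).2 this.le
    have h3 := Finset.card_le_card this
    rw [Finset.card_range] at h3
    calc _ ≤ ((N / L ^ j : ℕ) : ℝ) := by exact_mod_cast h3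
      _ ≤ _ := by
        refine Nat.cast_div_le.trans (by push_cast; rfl)
  calc _ ≤ N / (L : ℝ) ^ j * ((L : ℝ) ^ j) ^ γ := by gcongr
    _ = N * ((L : ℝ) ^ j) ^ (γ - 1) := by
      rw [Real.rpow_sub_one (by positivity)]; ring
    _ ≤ N * (L : ℝ) ^ (γ - 1) := by
      refine mul_le_mul_of_nonneg_left ?_ (Nat.cast_nonneg N)
      refine Real.rpow_le_rpow_of_nonpos hL0 ?_ (by linarith)
      exact le_self_pow₀ hL1 (by omega)

/-- The integral is restricted to the event that the whole hierarchy is open; there every distance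
is at most 2(M+1)L. -/
theorem exp_neg_le_partitionFunction {N M L : ℕ} (hL : 1 ≤ L) (hN : N ≤ L ^ (M + 1)) (γ b : ℝ)
    {p : ℝ≥0∞} (hp : 1 ≤ p) (hγ : M = 0 ∨ γ ≤ 1) :
    Real.exp (-(M * (N * (L : ℝ) ^ (γ - 1)) + (N : ℝ) ^ b * (2 * ((M + 1) * L)))) ≤
      partitionFunction N γ b p := by
  set A := {ω : Sym2 ℤ → Bool | ∀ e ∈ layerEdges N M L, ω e = true} with hA
  set c := (N : ℝ) ^ b * (2 * ((M + 1) * L)) with hc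
  have hAm : MeasurableSet A := by
    have : A = Set.pi (layerEdges N M L : Set (Sym2 ℤ)) fun _ => {true} := by
      ext ω; simp [Set.mem_pi, hA]
    rw [this]
    exact MeasurableSet.pi (Finset.countable_toSet _) fun _ _ => measurableSet_singleton _
  have hH : ∀ ω ∈ A, hamiltonian N b p ω ≤ c := by
    intro ω hω
    have h := energy_le_of_forall_within hp (g := graphOf (segment N) ω) rfl
      (within_of_layerEdges hL hN hω)
    refine mul_le_mul_of_nonneg_left ?_ (by positivity)
    have h2 := ENNReal.toReal_mono (ENNReal.natCast_ne_top _) h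
    rw [ENNReal.toReal_natCast] at h2
    exact_mod_cast h2
  have h1 : (edgeMeasure γ).real A * Real.exp (-c) ≤ partitionFunction N γ b p := by
    have h2 : ∫ ω, A.indicator (fun _ => Real.exp (-c)) ω ∂edgeMeasure γ ≤
        partitionFunction N γ b p := by
      refine integral_mono ((integrable_const _).indicator hAm)
        (integrable_exp_neg_hamiltonian N γ b p) fun ω => ?_
      by_cases hω : ω ∈ A
      · simp only [Set.indicator_of_mem hω]
        exact Real.exp_le_exp.2 (neg_le_neg (hH ω hω))
      · simp only [Set.indicator_of_notMem hω]
        exact (Real.exp_pos _).le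
    rwa [integral_indicator_const _ hAm, smul_eq_mul] at h2
  refine le_trans ?_ h1
  rw [hA, edgeMeasure_real_forall, ← Real.exp_add]
  refine Real.exp_le_exp.2 ?_
  have := sum_layerEdges_le (N := N) (M := M) hL hγ
  linarith

theorem energy_ne_top {p : ℝ≥0∞} (hp : 1 ≤ p) (N : ℕ) (ω : Sym2 ℤ → Bool) :
    energy p (graphOf (segment N) ω) ≠ ∞ := by
  rcases Nat.eq_zero_or_pos N with rfl | hN
  · refine ne_top_of_le_ne_top (ENNReal.natCast_ne_top 0)
      (energy_le_of_forall_within hp rfl fun x hx => ?_)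
    have h1 := hx.1
    have h2 := hx.2
    simp at h2
    omega
  -- With M = 0 no layer has to be opened: the nearest-neighbour path alone connects [N], for every
  -- ω.
  refine ne_top_of_le_ne_top (ENNReal.natCast_ne_top _) (energy_le_of_forall_within hp
    (g := graphOf (segment N) ω) rfl
    (within_of_layerEdges (M := 0) (L := N) hN (by simp) fun e he => ?_))
  simp [layerEdges, layerIndex] at he

/-! ### Large deviations of the long edges -/

theorem exists_sum_Ico_le {h : ℕ → ℝ} (hh : Summable h) {ε : ℝ} (hε : 0 < ε) :
    ∃ K₀, ∀ K ≥ K₀, ∀ N, ∑ r ∈ Finset.Ico K N, h r ≤ ε := by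
  obtain ⟨s, hs⟩ := summable_iff_vanishing_norm.1 hh ε hε
  obtain ⟨n, hn⟩ := s.bddAbove
  refine ⟨n + 1, fun K hK N => (le_abs_self _).trans (hs _ ?_).le⟩
  rw [Finset.disjoint_left]
  intro r hr hrs
  have h1 := hn hrs
  have h2 := (Finset.mem_Ico.1 hr).1
  omega

/-- Many long edges are unlikely. -/
theorem exists_edgeMeasure_card_le {γ : ℝ} (hγ : 0 < γ) {δ : ℝ} (hδ : 0 < δ) (c : ℝ) :
    ∃ K₀, ∀ K ≥ K₀, ∀ N : ℕ, (edgeMeasure γ).real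
      {ω | δ * N ≤ ∑ e ∈ longEdges N K, if ω e = true then (1 : ℝ) else 0} ≤
        Real.exp (-(c * N)) := by
  -- Weight l per edge makes δN edges worth (|c| + 1) N; large K keeps the exponential moment below
  -- N.
  set l := (|c| + 1) / δ with hl
  have hl0 : 0 < l := by positivity
  obtain ⟨K₀, hK₀⟩ := exists_sum_Ico_le ((summable_exp_neg_rpow hγ).mul_left (Real.exp l)) zero_lt_one
  refine ⟨K₀, fun K hK N => ?_⟩
  have h := edgeMeasure_real_le_sum_le γ (longEdges N K) (fun _ => l) (l * (δ * N))
  have hset : {ω : Sym2 ℤ → Bool | δ * N ≤ ∑ e ∈ longEdges N K, if ω e = true then (1 : ℝ) else 0} =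
      {ω | l * (δ * N) ≤ ∑ e ∈ longEdges N K, if ω e = true then l else 0} := by
    ext ω
    have : (∑ e ∈ longEdges N K, if ω e = true then l else 0) =
        l * ∑ e ∈ longEdges N K, if ω e = true then (1 : ℝ) else 0 := by
      rw [Finset.mul_sum]
      exact Finset.sum_congr rfl fun e _ => by split_ifs <;> simp
    rw [Set.mem_ofPred_eq, Set.mem_ofPred_eq, this, mul_le_mul_iff_right₀ hl0]
  rw [hset]
  refine h.trans (Real.exp_le_exp.2 ?_)
  have h2 : ∑ e ∈ longEdges N K, Real.exp (l - (edgeLength e : ℝ) ^ γ) ≤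
      N * ∑ r ∈ Finset.Ico K N, Real.exp l * Real.exp (-(r : ℝ) ^ γ) := by
    refine sum_longEdges_le (fun r => by positivity) fun x r => ?_
    rw [edgeLength_mk_add, sub_eq_add_neg, Real.exp_add]
    simp
  have h3 : l * (δ * N) = (|c| + 1) * N := by
    rw [hl]; field_simp
  have h4 := hK₀ K hK N
  have h5 := le_abs_self c
  have hN : (0 : ℝ) ≤ N := Nat.cast_nonneg N
  nlinarith

/-- For `γ = 1`, the cost of a large total length of the long edges. -/
theorem exists_edgeMeasure_openLength_le {m ε : ℝ} (hm : 0 ≤ m) (hε : 0 < ε) :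
    ∃ K₀, ∀ K ≥ K₀, ∀ N : ℕ, (edgeMeasure 1).real {ω | (m - ε) * N ≤ openLength N K ω} ≤
      Real.exp (-((m - 3 * ε) * N)) := by
  -- The weight (1-s) · length keeps the exponential moments summable. It loses s(m-ε) ≤ ε in the
  -- rate and the moment term loses another ε; with the ε in the threshold this makes 3ε.
  set s := ε / (m + ε) with hs
  have hs0 : 0 < s := by positivity
  have hs1 : s ≤ 1 := by rw [hs, div_le_one (by positivity)]; linarith
  have hsum : Summable fun r : ℕ => Real.exp (-(s * r)) := by
    have := Real.summable_exp_nat_mul_iff.2 (neg_lt_zero.2 hs0)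
    refine this.congr fun r => ?_
    congr 1; ring
  obtain ⟨K₀, hK₀⟩ := exists_sum_Ico_le hsum hε
  refine ⟨K₀, fun K hK N => ?_⟩
  have h := edgeMeasure_real_le_sum_le 1 (longEdges N K) (fun e => (1 - s) * edgeLength e)
    ((1 - s) * ((m - ε) * N))
  refine le_trans (measureReal_mono fun ω hω => ?_) (h.trans (Real.exp_le_exp.2 ?_))
  · have : (∑ e ∈ longEdges N K, if ω e = true then (1 - s) * (edgeLength e : ℝ) else 0) =
        (1 - s) * openLength N K ω := by
      rw [openLength, Finset.mul_sum]
      exact Finset.sum_congr rfl fun e _ => by split_ifs <;> simp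
    rw [Set.mem_ofPred_eq, this]
    exact mul_le_mul_of_nonneg_left hω (by linarith)
  · have h2 : ∑ e ∈ longEdges N K, Real.exp ((1 - s) * edgeLength e - (edgeLength e : ℝ) ^ (1 : ℝ)) ≤
        N * ∑ r ∈ Finset.Ico K N, Real.exp (-(s * r)) := by
      refine sum_longEdges_le (fun r => by positivity) fun x r => ?_
      rw [edgeLength_mk_add, Real.rpow_one]
      congr 1
      push_cast
      ring
    have h4 := hK₀ K hK N
    have hN : (0 : ℝ) ≤ N := Nat.cast_nonneg N
    have h5 : s * (m - ε) ≤ ε := by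
      have : s * (m + ε) = ε := by rw [hs]; field_simp
      nlinarith
    nlinarith

/-! ### Localization of patterns and concentration of their frequency -/

/-- If the ball in `g` matches the pattern, its vertex set is the known translate of `h.verts`;
hence agreement of the two graphs at these vertices is enough. -/
theorem rootedEq_ball_of_agree {g g' h : GraphOnZ} {o o' : ℤ} {R : ℝ} (hR : 0 ≤ R) (ho : o' ∈ h.verts)
    (hg : ∀ x, x - o + o' ∈ h.verts →
      x ∈ g.verts ∧ x ∈ g'.verts ∧ ∀ y, g.Adj x y ↔ g'.Adj x y)
    (H : RootedEq (ball g o R) o h o') : RootedEq (ball g' o R) o h o' := by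
  rw [rootedEq_iff] at H ⊢
  have hv : ∀ x, x ∈ (ball g o R).verts → x - o + o' ∈ h.verts := fun x hx => by
    rwa [H, translate_verts] at hx
  rw [← H]
  exact ball_eq_of_adj_iff hR (hg o (by simpa using ho)).1 (fun x hx => (hg x (hv x hx)).2.1)
    fun x hx => (hg x (hv x hx)).2.2

theorem rootedEq_ball_congr {g g' h : GraphOnZ} {o o' : ℤ} {R : ℝ} (hR : 0 ≤ R)
    (ho : o' ∈ h.verts)
    (hg : ∀ x, x - o + o' ∈ h.verts →
      x ∈ g.verts ∧ x ∈ g'.verts ∧ ∀ y, g.Adj x y ↔ g'.Adj x y) :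
    RootedEq (ball g o R) o h o' ↔ RootedEq (ball g' o R) o h o' :=
  ⟨rootedEq_ball_of_agree hR ho hg, rootedEq_ball_of_agree hR ho fun x hx =>
    ⟨(hg x hx).2.1, (hg x hx).1, fun y => ((hg x hx).2.2 y).symm⟩⟩

/-- The pairs `{o + w, y}` with `w ∈ W` and `|o + w - y| < K`. -/
noncomputable def localEdges (W : Finset ℤ) (K : ℕ) (o : ℤ) : Finset (Sym2 ℤ) :=
  (W ×ˢ Finset.Ioo (-(K : ℤ)) K).image fun q => s(o + q.1, o + q.1 + q.2)

theorem mk_mem_localEdges {W : Finset ℤ} {K : ℕ} {o x y : ℤ} (hx : x - o ∈ W)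
    (hxy : |x - y| < K) : s(x, y) ∈ localEdges W K o := by
  rw [abs_lt] at hxy
  refine Finset.mem_image.2 ⟨(x - o, y - x), ?_, ?_⟩
  · simp only [Finset.mem_product, Finset.mem_Ioo]
    exact ⟨hx, by omega, by omega⟩
  · dsimp only
    rw [add_sub_cancel, add_sub_cancel]

theorem edgeLength_lt_of_mem_localEdges {W : Finset ℤ} {K : ℕ} {o : ℤ} {e : Sym2 ℤ}
    (he : e ∈ localEdges W K o) : edgeLength e < K := by
  obtain ⟨⟨w, r⟩, hq, rfl⟩ := Finset.mem_image.1 he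
  simp only [Finset.mem_product, Finset.mem_Ioo] at hq
  simp only [edgeLength, Sym2.lift_mk, abs_lt]
  omega

theorem disjoint_localEdges {W : Finset ℤ} {K D : ℕ} (hD : ∀ w ∈ W, |w| ≤ D) {o o' : ℤ}
    (h : (2 * D + K : ℤ) ≤ |o - o'|) : Disjoint (localEdges W K o) (localEdges W K o') := by
  rw [Finset.disjoint_left]
  intro e he he'
  obtain ⟨⟨w, r⟩, hq, rfl⟩ := Finset.mem_image.1 he
  obtain ⟨⟨w', r'⟩, hq', he⟩ := Finset.mem_image.1 he'
  simp only [Finset.mem_product, Finset.mem_Ioo] at hq hq'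
  have h1 := abs_le.1 (hD w hq.1)
  have h2 := abs_le.1 (hD w' hq'.1)
  have h3 : |o - o'| < 2 * D + K := by
    rw [abs_lt]
    rcases Sym2.eq_iff.1 he with h | h <;> simp only at h <;> omega
  omega

open Classical in
/-- The configuration restricted to a finite set of edges. -/
noncomputable def restrictConfig (S : Finset (Sym2 ℤ)) (ω : Sym2 ℤ → Bool) : Sym2 ℤ → Bool :=
  fun e => if e ∈ S then ω e else false

theorem dependsOn_restrictConfig (S : Finset (Sym2 ℤ)) :
    DependsOn (restrictConfig S) (S : Set (Sym2 ℤ)) := by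
  intro ω ω' h
  funext e
  simp only [restrictConfig]
  split_ifs with he
  · exact h e he
  · rfl

/-- If no vertex of the candidate ball meets an open edge of length at least K, the pattern is
decided by finitely many short edges. The same statement compares both [N] and ℤ with the local
event. -/
theorem rootedEq_ball_restrictConfig {h : GraphOnZ} {o o' : ℤ} {R : ℝ} (hR : 0 ≤ R)
    (ho : o' ∈ h.verts) {W : Finset ℤ} (hW : ∀ x, x ∈ W ↔ x + o' ∈ h.verts) {K : ℕ} (hK : 2 ≤ K)
    {V : Set ℤ} {ω : Sym2 ℤ → Bool} (hV : ∀ x, x - o ∈ W → ∀ y, |x - y| < K → y ∈ V)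
    (hω : ∀ x, x - o ∈ W → ∀ y ∈ V, K ≤ |x - y| → ω s(x, y) = false) :
    RootedEq (ball (graphOf V ω) o R) o h o' ↔
      RootedEq (ball (graphOf univ (restrictConfig (localEdges W K o) ω)) o R) o h o' := by
  refine rootedEq_ball_congr hR ho fun x hx => ?_
  have hx := (hW _).2 hx
  have hxV := hV x hx x (by simp; omega)
  refine ⟨hxV, trivial, fun y => ?_⟩
  constructor
  · rintro ⟨-, hy, hne, hor⟩
    refine ⟨trivial, trivial, hne, ?_⟩
    by_cases hxy : |x - y| < K
    · rwa [restrictConfig, if_pos (mk_mem_localEdges hx hxy)]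
    · rw [hω x hx y hy (not_lt.1 hxy)] at hor
      simp only [Bool.false_eq_true, or_false] at hor
      omega
  · rintro ⟨-, -, hne, hor⟩
    by_cases hxy : |x - y| < K
    · rw [restrictConfig, if_pos (mk_mem_localEdges hx hxy)] at hor
      exact ⟨hxV, hV x hx y hxy, hne, hor⟩
    · have hloc : s(x, y) ∉ localEdges W K o := fun hmem => by
        have := edgeLength_lt_of_mem_localEdges hmem
        simp only [edgeLength, Sym2.lift_mk] at this
        exact hxy this
      rw [restrictConfig, if_neg hloc] at hor
      simp only [Bool.false_eq_true, or_false] at hor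
      omega

/-- It is unlikely that a given vertex is incident to a very long edge. -/
theorem exists_edgeMeasure_long_le {γ : ℝ} (hγ : 0 < γ) {ε : ℝ} (hε : 0 < ε) :
    ∃ K₀ : ℕ, ∀ K ≥ K₀, ∀ x : ℤ, (edgeMeasure γ).real
      {ω | ∃ y, (K : ℤ) ≤ |x - y| ∧ ω s(x, y) = true} ≤ ε := by
  have htop : ∑' r : ℕ, 2 * ENNReal.ofReal (Real.exp (-(r : ℝ) ^ γ)) ≠ ∞ := by
    rw [ENNReal.tsum_mul_left]
    exact ENNReal.mul_ne_top (by simp) (summable_exp_neg_rpow hγ).tsum_ofReal_ne_top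
  have h := (ENNReal.tendsto_sum_nat_add _ htop).eventually_le_const
    (ENNReal.ofReal_pos.2 hε)
  obtain ⟨K₀, hK₀⟩ := eventually_atTop.1 h
  refine ⟨K₀, fun K hK x => ?_⟩
  refine ENNReal.toReal_le_of_le_ofReal hε.le (le_trans ?_ (hK₀ K hK))
  have hsub : {ω : Sym2 ℤ → Bool | ∃ y, (K : ℤ) ≤ |x - y| ∧ ω s(x, y) = true} ⊆
      ⋃ k : ℕ, ({ω | ω s(x, x + (k + K : ℕ)) = true} ∪
        {ω | ω s(x - (k + K : ℕ), x - (k + K : ℕ) + (k + K : ℕ)) = true}) := by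
    rintro ω ⟨y, hy, hω⟩
    rw [Set.mem_iUnion]
    rcases le_total x y with hxy | hxy
    · rw [abs_sub_comm, abs_of_nonneg (by omega)] at hy
      refine ⟨(y - x - K).toNat, Or.inl ?_⟩
      rwa [Set.mem_ofPred_eq, show x + (((y - x - K).toNat + K : ℕ) : ℤ) = y by omega]
    · rw [abs_of_nonneg (by omega)] at hy
      refine ⟨(x - y - K).toNat, Or.inr ?_⟩
      rwa [Set.mem_ofPred_eq, show x - (((x - y - K).toNat + K : ℕ) : ℤ) = y by omega,
        show y + (((x - y - K).toNat + K : ℕ) : ℤ) = x by omega, Sym2.eq_swap]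
  refine (measure_mono hsub).trans ((measure_iUnion_le _).trans (ENNReal.tsum_le_tsum fun k => ?_))
  refine (measure_union_le _ _).trans (le_of_eq ?_)
  rw [edgeMeasure_open, edgeMeasure_open, edgeLength_mk_add, edgeLength_mk_add, two_mul]
  simp

/-- Concentration of a sum of indicators that depend on the edges around the vertices of `[N]`. -/
theorem edgeMeasure_sum_local_le (γ : ℝ) {W : Finset ℤ} {K D : ℕ} (hD : ∀ w ∈ W, |w| ≤ D)
    (hK : 1 ≤ K) {X : ℤ → (Sym2 ℤ → Bool) → ℝ}
    (hX : ∀ o, DependsOn (X o) (localEdges W K o : Set (Sym2 ℤ)))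
    (hb : ∀ o ω, X o ω ∈ Icc (0 : ℝ) 1) {ε : ℝ} (hε : 0 < ε) {N : ℕ} (hN : 0 < N) :
    (edgeMeasure γ).real {ω | ε * N ≤ |∑ o ∈ Finset.Icc (1 : ℤ) N,
      (X o ω - ∫ ω', X o ω' ∂edgeMeasure γ)|} ≤
      (2 * (2 * D + K)) * Real.exp (-(2 * (ε / (2 * D + K)) ^ 2 * N)) := by
  -- Roots in the same residue class mod M are at distance at least M, so their local edge sets are
  -- disjoint and their variables independent. The sub-Gaussian bound is applied class by class.
  set M : ℕ := 2 * D + K with hM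
  have hM0 : 0 < M := by omega
  have hM0' : (0 : ℝ) < M := by exact_mod_cast hM0
  have hMcast : (2 * D + K : ℝ) = M := by rw [hM]; push_cast; ring
  rw [hMcast]
  have hN' : (0 : ℝ) < N := by exact_mod_cast hN
  set Y : ℤ → (Sym2 ℤ → Bool) → ℝ := fun o ω => X o ω - ∫ ω', X o ω' ∂edgeMeasure γ with hY
  set cls : ℕ → Finset ℤ := fun r => (Finset.Icc (1 : ℤ) N).filter fun o => (o % M).toNat = r
    with hcls
  have hsplit : ∀ ω, ∑ o ∈ Finset.Icc (1 : ℤ) N, Y o ω =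
      ∑ r ∈ Finset.range M, ∑ o ∈ cls r, Y o ω := by
    intro ω
    refine (Finset.sum_fiberwise_of_maps_to (fun o _ => ?_) _).symm
    have h1 := Int.emod_nonneg o (b := (M : ℤ)) (by omega)
    have h2 := Int.emod_lt_of_pos o (b := (M : ℤ)) (by omega)
    rw [Finset.mem_range]
    omega
  have hsub : ∀ r, HasSubgaussianMGF (fun ω => ∑ o ∈ cls r, Y o ω) ((cls r).card * (1 / 4))
      (edgeMeasure γ) := by
    intro r
    refine hasSubgaussianMGF_sum_of_dependsOn γ (cls r) (fun o _ => hX o) ?_ fun o _ => hb o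
    intro o ho o' ho' hne
    refine disjoint_localEdges hD ?_
    simp only [hcls, Finset.coe_filter, Set.mem_ofPred_eq] at ho ho'
    have h1 := Int.emod_nonneg o (b := (M : ℤ)) (by omega)
    have h2 := Int.emod_nonneg o' (b := (M : ℤ)) (by omega)
    have h3 : o % (M : ℤ) = o' % (M : ℤ) := by omega
    have h4 : (M : ℤ) ∣ o - o' := (Int.ModEq.dvd (show o' ≡ o [ZMOD M] from h3.symm))
    by_contra hlt
    refine hne (sub_eq_zero.1 (Int.eq_zero_of_abs_lt_dvd h4 ?_))
    rw [hM]
    push_cast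
    omega
  have htail : ∀ (r : ℕ) (Z : (Sym2 ℤ → Bool) → ℝ),
      HasSubgaussianMGF Z ((cls r).card * (1 / 4)) (edgeMeasure γ) → ((cls r).card = 0 → Z = 0) →
      (edgeMeasure γ).real {ω | ε * N / M ≤ Z ω} ≤ Real.exp (-(2 * (ε / M) ^ 2 * N)) := by
    intro r Z hZ hZ0
    -- An empty class has variance proxy 0, where the sub-Gaussian tail bound degenerates.
    rcases Nat.eq_zero_or_pos (cls r).card with hc | hc
    · rw [hZ0 hc]
      have : {ω : Sym2 ℤ → Bool | ε * N / M ≤ (0 : (Sym2 ℤ → Bool) → ℝ) ω} = ∅ := by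
        refine Set.eq_empty_of_forall_notMem fun ω hω => ?_
        have h1 : ε * N / M ≤ 0 := hω
        have h2 : 0 < ε * N / M := by positivity
        linarith
      rw [this]
      simpa using (Real.exp_pos _).le
    · refine (hZ.measure_ge_le (by positivity)).trans (Real.exp_le_exp.2 ?_)
      have hc' : (0 : ℝ) < (cls r).card := by exact_mod_cast hc
      have hcN : ((cls r).card : ℝ) ≤ N := by
        have := Finset.card_filter_le (Finset.Icc (1 : ℤ) N) fun o => (o % M).toNat = r
        rw [Int.card_Icc] at this
        exact_mod_cast this.trans (by simp)
      push_cast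
      rw [neg_div, neg_le_neg_iff, le_div_iff₀ (by positivity)]
      calc 2 * (ε / M) ^ 2 * N * (2 * ((cls r).card * (1 / 4)))
          = (ε / M) ^ 2 * N * (cls r).card := by ring
        _ ≤ (ε / M) ^ 2 * N * N := by gcongr
        _ = (ε * N / M) ^ 2 := by ring
  have hcover : {ω | ε * N ≤ |∑ o ∈ Finset.Icc (1 : ℤ) N, Y o ω|} ⊆
      ⋃ r ∈ Finset.range M, ({ω | ε * N / M ≤ ∑ o ∈ cls r, Y o ω} ∪
        {ω | ε * N / M ≤ (-fun ω => ∑ o ∈ cls r, Y o ω) ω}) := by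
    intro ω hω
    by_contra hcon
    simp only [Set.mem_iUnion, not_exists, Set.mem_union, Set.mem_ofPred_eq, not_or, not_le,
      Pi.neg_apply] at hcon
    have h1 : |∑ o ∈ Finset.Icc (1 : ℤ) N, Y o ω| < ε * N := by
      rw [hsplit]
      refine (Finset.abs_sum_le_sum_abs _ _).trans_lt ?_
      calc _ < ∑ r ∈ Finset.range M, ε * N / M := by
            refine Finset.sum_lt_sum_of_nonempty ⟨0, by simpa using hM0⟩ fun r hr => ?_
            rw [abs_lt]
            have := hcon r hr
            constructor <;> linarith
        _ = ε * N := by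
            rw [Finset.sum_const, Finset.card_range, nsmul_eq_mul]
            field_simp
    exact absurd hω (not_le.2 h1)
  refine (measureReal_mono hcover (measure_ne_top _ _)).trans ((measureReal_biUnion_finset_le _ _).trans ?_)
  calc _ ≤ ∑ r ∈ Finset.range M, 2 * Real.exp (-(2 * (ε / M) ^ 2 * N)) := by
        refine Finset.sum_le_sum fun r _ => (measureReal_union_le _ _).trans ?_
        have h0 : (cls r).card = 0 → (fun ω => ∑ o ∈ cls r, Y o ω) = 0 := fun h => by
          rw [Finset.card_eq_zero.1 h]; rfl
        have h1 := htail r _ (hsub r) h0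
        have h2 := htail r _ (hsub r).neg fun h => by rw [h0 h, neg_zero]
        linarith
    _ = _ := by
        rw [Finset.sum_const, Finset.card_range, nsmul_eq_mul]
        ring

/-- The event that the ball around `o` in the graph on `V` is a translate of `(h, o')`. -/
def patternEvent (h : GraphOnZ) (o' : ℤ) (R : ℝ) (V : Set ℤ) (o : ℤ) : Set (Sym2 ℤ → Bool) :=
  {ω | RootedEq (ball (graphOf V ω) o R) o h o'}

/-- The truncation of `patternEvent` to edges of length less than `K`. -/
def localEvent (h : GraphOnZ) (o' : ℤ) (R : ℝ) (W : Finset ℤ) (K : ℕ) (o : ℤ) :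
    Set (Sym2 ℤ → Bool) :=
  {ω | restrictConfig (localEdges W K o) ω ∈ patternEvent h o' R univ o}

/-- The number of vertices of `[N]` whose neighbourhood is a translate of `(h, o')`. -/
noncomputable def patternCount (h : GraphOnZ) (o' : ℤ) (R : ℝ) (N : ℕ) (ω : Sym2 ℤ → Bool) : ℝ :=
  ∑ o ∈ Finset.Icc (1 : ℤ) N, (patternEvent h o' R (segment N) o).indicator (fun _ => 1) ω

theorem measurableSet_patternEvent (h : GraphOnZ) (o' : ℤ) {R : ℝ} (hR : 0 ≤ R) (V : Set ℤ)
    (o : ℤ) : MeasurableSet (patternEvent h o' R V o) :=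
  measurable_graphOf V (measurableSet_rootedEq_ball o o' h hR)

theorem dependsOn_localEvent (h : GraphOnZ) (o' : ℤ) (R : ℝ) (W : Finset ℤ) (K : ℕ) (o : ℤ) :
    DependsOn (· ∈ localEvent h o' R W K o) (localEdges W K o : Set (Sym2 ℤ)) := fun ω ω' hω => by
  simp only [localEvent, Set.mem_ofPred_eq, dependsOn_restrictConfig _ hω]

theorem measurableSet_of_dependsOn {A : Set (Sym2 ℤ → Bool)} {S : Finset (Sym2 ℤ)}
    (h : DependsOn (· ∈ A) (S : Set (Sym2 ℤ))) : MeasurableSet A :=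
  measurableSet_setOfPred.2 (measurable_of_dependsOn h)

theorem dependsOn_indicator_localEvent (h : GraphOnZ) (o' : ℤ) (R : ℝ) (W : Finset ℤ) (K : ℕ)
    (o : ℤ) : DependsOn ((localEvent h o' R W K o).indicator fun _ => (1 : ℝ))
      (localEdges W K o : Set (Sym2 ℤ)) := fun ω ω' hω => by
  have := dependsOn_localEvent h o' R W K o hω
  simp only [eq_iff_iff] at this
  by_cases hm : ω ∈ localEvent h o' R W K o
  · rw [Set.indicator_of_mem hm, Set.indicator_of_mem (this.1 hm)]
  · rw [Set.indicator_of_notMem hm, Set.indicator_of_notMem fun h' => hm (this.2 h')]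

theorem indicator_one_mem_Icc {Ω : Type*} (A : Set Ω) (ω : Ω) :
    A.indicator (fun _ => (1 : ℝ)) ω ∈ Icc (0 : ℝ) 1 := by
  by_cases h : ω ∈ A <;> simp [h]

theorem sum_longEdges_open (N K : ℕ) (ω : Sym2 ℤ → Bool) :
    (∑ e ∈ longEdges N K, if ω e = true then (1 : ℝ) else 0) =
      ((longPairs N K).filter fun q => ω s(q.1, q.1 + q.2) = true).card := by
  rw [sum_longEdges, Finset.sum_boole]

/-- The true and the local pattern can differ only at roots within D + K of the ends of [N], or at
roots o with o + w an endpoint of a long open edge for some w in `W`. -/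
theorem abs_patternCount_sub_le {h : GraphOnZ} {o' : ℤ} {R : ℝ} (hR : 0 ≤ R) (ho : o' ∈ h.verts)
    {W : Finset ℤ} (hW : ∀ x, x ∈ W ↔ x + o' ∈ h.verts) {D K : ℕ} (hD : ∀ w ∈ W, |w| ≤ D)
    (hK : 2 ≤ K) (N : ℕ) (ω : Sym2 ℤ → Bool) :
    |patternCount h o' R N ω - ∑ o ∈ Finset.Icc (1 : ℤ) N,
      (localEvent h o' R W K o).indicator (fun _ => 1) ω| ≤
      2 * (D + K) + 2 * W.card *
        ∑ e ∈ longEdges N K, if ω e = true then (1 : ℝ) else 0 := by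
  classical
  set P := (longPairs N K).filter fun q => ω s(q.1, q.1 + q.2) = true with hP
  set B : Finset ℤ := (Finset.Icc 1 ((D + K : ℕ) : ℤ) ∪ Finset.Ioc ((N : ℤ) - (D + K : ℕ)) N) ∪
    P.biUnion fun q => W.image (fun w => q.1 - w) ∪ W.image (fun w => q.1 + q.2 - w) with hB
  have hBcard : B.card ≤ (D + K) + (D + K) + P.card * (W.card + W.card) := by
    refine (Finset.card_union_le _ _).trans (add_le_add ((Finset.card_union_le _ _).trans ?_) ?_)
    · rw [Int.card_Icc, Int.card_Ioc]
      omega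
    · refine Finset.card_biUnion_le_card_mul _ _ _ fun q _ => (Finset.card_union_le _ _).trans ?_
      exact add_le_add Finset.card_image_le Finset.card_image_le
  have hagree : ∀ o ∈ Finset.Icc (1 : ℤ) N, o ∉ B →
      (ω ∈ patternEvent h o' R (segment N) o ↔ ω ∈ localEvent h o' R W K o) := by
    intro o ho1 hoB
    simp only [hB, Finset.mem_union, not_or, Finset.mem_Icc, Finset.mem_Ioc] at hoB ho1
    obtain ⟨⟨h1, h2⟩, h3⟩ := hoB
    refine rootedEq_ball_restrictConfig hR ho hW hK ?_ ?_
    · intro x hx y hxy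
      have h4 := abs_le.1 (hD _ hx)
      have h5 := abs_lt.1 hxy
      exact ⟨by omega, by omega⟩
    · intro x hx y hy hxy
      have h4 := abs_le.1 (hD _ hx)
      by_contra hω
      rw [Bool.not_eq_false] at hω
      have hxV : x ∈ segment N := ⟨by omega, by omega⟩
      obtain ⟨q, hq, he⟩ := Finset.mem_image.1 (mk_mem_longEdges.2 ⟨hxV, hy, hxy⟩)
      refine h3 (Finset.mem_biUnion.2 ⟨q, Finset.mem_filter.2 ⟨hq, ?_⟩, ?_⟩)
      · rw [he]; exact hω
      · rcases Sym2.eq_iff.1 he with ⟨h6, h7⟩ | ⟨h6, h7⟩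
        · exact Finset.mem_union_left _ (Finset.mem_image.2 ⟨x - o, hx, by omega⟩)
        · exact Finset.mem_union_right _ (Finset.mem_image.2 ⟨x - o, hx, by omega⟩)
  rw [patternCount, ← Finset.sum_sub_distrib, sum_longEdges_open, ← hP]
  refine (Finset.abs_sum_le_sum_abs _ _).trans ?_
  calc _ ≤ ∑ o ∈ Finset.Icc (1 : ℤ) N, if o ∈ B then (1 : ℝ) else 0 := by
        refine Finset.sum_le_sum fun o ho1 => ?_
        split_ifs with hoB
        · have h1 := indicator_one_mem_Icc (patternEvent h o' R (segment N) o) ω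
          have h2 := indicator_one_mem_Icc (localEvent h o' R W K o) ω
          rw [abs_le]
          exact ⟨by linarith [h1.1, h2.2], by linarith [h1.2, h2.1]⟩
        · have := hagree o ho1 hoB
          by_cases hm : ω ∈ localEvent h o' R W K o
          · rw [Set.indicator_of_mem hm, Set.indicator_of_mem (this.2 hm)]; simp
          · rw [Set.indicator_of_notMem hm, Set.indicator_of_notMem fun h' => hm (this.1 h')]; simp
    _ = ((Finset.Icc (1 : ℤ) N).filter fun o => o ∈ B).card := Finset.sum_boole _ _
    _ ≤ B.card := by
        exact_mod_cast Finset.card_le_card fun o ho => (Finset.mem_filter.1 ho).2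
    _ ≤ (((D + K) + (D + K) + P.card * (W.card + W.card) : ℕ) : ℝ) := by exact_mod_cast hBcard
    _ = _ := by push_cast; ring

/-- On ℤ the two events differ only if one of the vertices o + w has an edge of length at least K;
stationarity then moves the root to 0. -/
theorem abs_measureReal_localEvent_sub_le {γ : ℝ} {h : GraphOnZ} {o' : ℤ} {R : ℝ} (hR : 0 ≤ R)
    (ho : o' ∈ h.verts) {W : Finset ℤ} (hW : ∀ x, x ∈ W ↔ x + o' ∈ h.verts) {K : ℕ}
    (hK : 2 ≤ K) {ε : ℝ} (hε : ∀ x : ℤ, (edgeMeasure γ).real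
      {ω | ∃ y, (K : ℤ) ≤ |x - y| ∧ ω s(x, y) = true} ≤ ε) (o : ℤ) :
    |(edgeMeasure γ).real (localEvent h o' R W K o) -
      (edgeMeasure γ).real (patternEvent h o' R univ 0)| ≤ W.card * ε := by
  set E : Set (Sym2 ℤ → Bool) :=
    ⋃ w ∈ W, {ω | ∃ y, (K : ℤ) ≤ |(o + w) - y| ∧ ω s(o + w, y) = true} with hE
  have hEle : (edgeMeasure γ).real E ≤ W.card * ε := by
    refine (measureReal_biUnion_finset_le _ _).trans ((Finset.sum_le_sum fun w _ => hε (o + w)).trans ?_)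
    simp
  have hagree : ∀ ω, ω ∉ E → (ω ∈ patternEvent h o' R univ o ↔ ω ∈ localEvent h o' R W K o) := by
    intro ω hω
    refine rootedEq_ball_restrictConfig hR ho hW hK (fun _ _ _ _ => trivial) ?_
    intro x hx y _ hxy
    by_contra hω'
    rw [Bool.not_eq_false] at hω'
    refine hω (Set.mem_biUnion hx ⟨y, ?_, ?_⟩)
    · rwa [add_sub_cancel]
    · rwa [add_sub_cancel]
  have hq : (edgeMeasure γ).real (patternEvent h o' R univ o) =
      (edgeMeasure γ).real (patternEvent h o' R univ 0) := by
    rw [measureReal_def, measureReal_def, patternEvent, edgeMeasure_rootedEq_ball_eq γ o o' h hR]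
    rfl
  rw [← hq]
  have h1 : (edgeMeasure γ).real (patternEvent h o' R univ o) ≤
      (edgeMeasure γ).real (localEvent h o' R W K o) + (edgeMeasure γ).real E := by
    refine (measureReal_mono (fun ω hω => ?_)).trans (measureReal_union_le _ _)
    by_cases hωE : ω ∈ E
    · exact Or.inr hωE
    · exact Or.inl ((hagree ω hωE).1 hω)
  have h2 : (edgeMeasure γ).real (localEvent h o' R W K o) ≤
      (edgeMeasure γ).real (patternEvent h o' R univ o) + (edgeMeasure γ).real E := by
    refine (measureReal_mono (fun ω hω => ?_)).trans (measureReal_union_le _ _)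
    by_cases hωE : ω ∈ E
    · exact Or.inr hωE
    · exact Or.inl ((hagree ω hωE).2 hω)
  rw [abs_le]
  constructor <;> linarith

/-- Away from an event of probability at most `exp (- c N)` and an event that depends only on short
edges and has exponentially small probability, the frequency of a pattern is close to its
infinite-volume probability. -/
theorem exists_patternCount_deviation {γ : ℝ} (hγ : 0 < γ) {h : GraphOnZ} {o' : ℤ} {R : ℝ}
    (hR : 0 ≤ R) (ho : o' ∈ h.verts) (hfin : h.verts.Finite) {ε : ℝ} (hε : 0 < ε) (c : ℝ) :
    ∃ K : ℕ, ∃ C c' : ℝ, 0 < C ∧ 0 < c' ∧ ∀ᶠ N : ℕ in atTop, ∃ (P Q : Set (Sym2 ℤ → Bool))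
      (F S : Finset (Sym2 ℤ)), DependsOn (· ∈ P) (F : Set (Sym2 ℤ)) ∧
      (edgeMeasure γ).real P ≤ Real.exp (-(c * N)) ∧
      DependsOn (· ∈ Q) (S : Set (Sym2 ℤ)) ∧ (∀ e ∈ S, edgeLength e < K) ∧
      (edgeMeasure γ).real Q ≤ C * Real.exp (-(c' * N)) ∧
      ∀ ω, ω ∉ P → ω ∉ Q → |patternCount h o' R N ω / N -
        (edgeMeasure γ).real (patternEvent h o' R univ 0)| ≤ ε := by
  classical
  set W : Finset ℤ := hfin.toFinset.image fun x => x - o' with hWdef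
  have hW : ∀ x, x ∈ W ↔ x + o' ∈ h.verts := by
    intro x
    simp only [hWdef, Finset.mem_image, Set.Finite.mem_toFinset]
    constructor
    · rintro ⟨y, hy, rfl⟩
      rwa [sub_add_cancel]
    · intro hx
      exact ⟨_, hx, by ring⟩
  obtain ⟨D, hD⟩ : ∃ D : ℕ, ∀ w ∈ W, |w| ≤ D := by
    refine ⟨W.sup fun w => w.natAbs, fun w hw => ?_⟩
    have := Finset.le_sup (f := fun w : ℤ => w.natAbs) hw
    rw [Int.abs_eq_natAbs]
    exact_mod_cast this
  set q := (edgeMeasure γ).real (patternEvent h o' R univ 0) with hq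
  set w : ℝ := W.card + 1 with hw
  have hw0 : 0 < w := by positivity
  -- The error ε is split into four quarters: long edges (`K₁`), bias of the truncated pattern
  -- (`K₂`), fluctuation of the local sum, and the ends of [N] (large N).
  obtain ⟨K₁, hK₁⟩ := exists_edgeMeasure_card_le hγ (δ := ε / (8 * w)) (by positivity) c
  obtain ⟨K₂, hK₂⟩ := exists_edgeMeasure_long_le hγ (ε := ε / (4 * w)) (by positivity)
  set K := max 2 (max K₁ K₂) with hK
  have hK2 : 2 ≤ K := le_max_left _ _
  refine ⟨K, 2 * (2 * D + K), 2 * (ε / 4 / (2 * D + K)) ^ 2, by positivity, by positivity, ?_⟩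
  set X : ℤ → (Sym2 ℤ → Bool) → ℝ := fun o => (localEvent h o' R W K o).indicator fun _ => 1 with hX
  have hXq : ∀ o, |(∫ ω, X o ω ∂edgeMeasure γ) - q| ≤ ε / 4 := by
    intro o
    have h1 : ∫ ω, X o ω ∂edgeMeasure γ = (edgeMeasure γ).real (localEvent h o' R W K o) :=
      integral_indicator_one (measurableSet_of_dependsOn (dependsOn_localEvent h o' R W K o))
    rw [h1]
    refine (abs_measureReal_localEvent_sub_le hR ho hW hK2
      (hK₂ K ((le_max_right _ _).trans (le_max_right _ _))) o).trans ?_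
    rw [mul_div_assoc', div_le_iff₀ (by positivity)]
    nlinarith
  filter_upwards [eventually_gt_atTop 0, eventually_ge_atTop ⌈8 * (D + K) / ε⌉₊] with N hN hNK
  have hN' : (0 : ℝ) < N := by exact_mod_cast hN
  have hNK' : 2 * (D + K : ℝ) ≤ ε / 4 * N := by
    have := (Nat.le_ceil _).trans (Nat.cast_le (α := ℝ).2 hNK)
    rw [div_le_iff₀ hε] at this
    linarith
  refine ⟨{ω | ε / (8 * w) * N ≤ ∑ e ∈ longEdges N K, if ω e = true then (1 : ℝ) else 0},
    {ω | ε / 4 * N ≤ |∑ o ∈ Finset.Icc (1 : ℤ) N, (X o ω - ∫ ω', X o ω' ∂edgeMeasure γ)|},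
    longEdges N K, (Finset.Icc (1 : ℤ) N).biUnion (localEdges W K), ?_, ?_, ?_, ?_, ?_, ?_⟩
  · intro ω ω' hω
    have : (∑ e ∈ longEdges N K, if ω e = true then (1 : ℝ) else 0) =
        ∑ e ∈ longEdges N K, if ω' e = true then (1 : ℝ) else 0 :=
      Finset.sum_congr rfl fun e he => by rw [hω e he]
    simp only [Set.mem_ofPred_eq, this]
  · exact hK₁ K ((le_max_left _ _).trans (le_max_right _ _)) N
  · intro ω ω' hω
    have : ∑ o ∈ Finset.Icc (1 : ℤ) N, (X o ω - ∫ ω', X o ω' ∂edgeMeasure γ) =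
        ∑ o ∈ Finset.Icc (1 : ℤ) N, (X o ω' - ∫ ω', X o ω' ∂edgeMeasure γ) := by
      refine Finset.sum_congr rfl fun o ho1 => ?_
      have hXo : X o ω = X o ω' := dependsOn_indicator_localEvent h o' R W K o fun e he =>
        hω e (Finset.mem_coe.2 (Finset.mem_biUnion.2 ⟨o, ho1, he⟩))
      rw [hXo]
    simp only [Set.mem_ofPred_eq, this]
  · intro e he
    obtain ⟨o, -, he⟩ := Finset.mem_biUnion.1 he
    exact edgeLength_lt_of_mem_localEdges he
  · exact edgeMeasure_sum_local_le γ hD (by omega) (dependsOn_indicator_localEvent h o' R W K)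
      (fun o ω => indicator_one_mem_Icc _ ω) (by positivity) hN
  · intro ω hP hQ
    simp only [Set.mem_ofPred_eq, not_le] at hP hQ
    have h1 := abs_patternCount_sub_le hR ho hW hD hK2 N ω
    have h2 : |∑ o ∈ Finset.Icc (1 : ℤ) N, (∫ ω', X o ω' ∂edgeMeasure γ) - q * N| ≤ ε / 4 * N := by
      have : ∑ o ∈ Finset.Icc (1 : ℤ) N, (∫ ω', X o ω' ∂edgeMeasure γ) - q * N =
          ∑ o ∈ Finset.Icc (1 : ℤ) N, ((∫ ω', X o ω' ∂edgeMeasure γ) - q) := by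
        rw [Finset.sum_sub_distrib]
        simp [mul_comm]
      rw [this]
      refine (Finset.abs_sum_le_sum_abs _ _).trans ((Finset.sum_le_sum fun o _ => hXq o).trans ?_)
      simp [mul_comm]
    have h3 : 2 * W.card * (∑ e ∈ longEdges N K, if ω e = true then (1 : ℝ) else 0) ≤
        ε / 4 * N := by
      have h4 : 2 * (W.card : ℝ) ≤ 2 * w := by rw [hw]; linarith
      calc _ ≤ 2 * w * (ε / (8 * w) * N) := by gcongr
        _ = ε / 4 * N := by field_simp; norm_num
    rw [Finset.sum_sub_distrib] at hQ
    have h5 : |patternCount h o' R N ω - q * N| ≤ ε * N := by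
      rw [abs_le] at *
      rw [abs_lt] at hQ
      constructor <;> linarith [h1.1, h1.2, h2.1, h2.2, hQ.1, hQ.2]
    rw [← div_le_iff₀ hN', ← abs_of_pos hN', ← abs_div, abs_of_pos hN', sub_div,
      mul_div_cancel_right₀ _ hN'.ne'] at h5
    exact h5

theorem measurable_patternCount (h : GraphOnZ) (o' : ℤ) {R : ℝ} (hR : 0 ≤ R) (N : ℕ) :
    Measurable (patternCount h o' R N) :=
  Finset.measurable_sum _ fun o _ =>
    measurable_const.indicator (measurableSet_patternEvent h o' hR (segment N) o)

theorem patternCount_mem_Icc (h : GraphOnZ) (o' : ℤ) (R : ℝ) (N : ℕ) (ω : Sym2 ℤ → Bool) :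
    patternCount h o' R N ω ∈ Icc (0 : ℝ) N := by
  constructor
  · exact Finset.sum_nonneg fun o _ => (indicator_one_mem_Icc _ ω).1
  · refine (Finset.sum_le_sum fun o _ => (indicator_one_mem_Icc _ ω).2).trans ?_
    simp

theorem tendsto_exp_neg_mul_nat {c : ℝ} (hc : 0 < c) :
    Tendsto (fun N : ℕ => Real.exp (-(c * N))) atTop (𝓝 0) :=
  Real.tendsto_exp_neg_atTop_nhds_zero.comp
    (tendsto_natCast_atTop_atTop.const_mul_atTop hc)

/-! ### Separation of scales under the Gibbs weight -/

/-- If the normalizing constant is at least `exp (-(m + o(1)) N)`, and if configurations with small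
energy lie in an event of long edges of probability at most `exp (-(m - o(1)) N)`, then the
frequency of a pattern under the Gibbs measure converges to its infinite-volume probability. -/
theorem tendsto_gibbs_patternCount {γ b m : ℝ} {p : ℝ≥0∞} (hγ : 0 < γ)
    (hZ : ∀ ε > 0, ∀ᶠ N : ℕ in atTop, Real.exp (-((m + ε) * N)) ≤ partitionFunction N γ b p)
    (hU : ∀ ε > 0, ∀ K : ℕ, ∀ᶠ N : ℕ in atTop, ∃ (T : Set (Sym2 ℤ → Bool)) (F : Finset (Sym2 ℤ)),
      DependsOn (· ∈ T) (F : Set (Sym2 ℤ)) ∧ (∀ e ∈ F, (K : ℤ) ≤ edgeLength e) ∧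
      (∀ ω, hamiltonian N b p ω ≤ (m + 1) * N → ω ∈ T) ∧
      (edgeMeasure γ).real T ≤ Real.exp (-((m - ε) * N)))
    {h : GraphOnZ} {o' : ℤ} {R : ℝ} (hR : 0 ≤ R) (ho : o' ∈ h.verts) (hfin : h.verts.Finite) :
    Tendsto (fun N : ℕ => (∫ ω, patternCount h o' R N ω / N *
      Real.exp (-hamiltonian N b p ω) ∂edgeMeasure γ) / partitionFunction N γ b p) atTop
      (𝓝 ((edgeMeasure γ).real (patternEvent h o' R univ 0))) := by
  set q := (edgeMeasure γ).real (patternEvent h o' R univ 0) with hq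
  refine Metric.tendsto_nhds.2 fun ε₀ hε₀ => ?_
  set ε := ε₀ / 3 with hε
  have hε0 : 0 < ε := by positivity
  -- The rate m + 1 makes `P` negligible against Z ≥ exp(-(m + ε') N). With ε' ≤ c'/4, the bound
  -- exp(-(c' + m - ε') N) on Q ∩ T is at most exp(-c'N/2) Z.
  obtain ⟨K, C, c', hC, hc', hdev⟩ := exists_patternCount_deviation hγ hR ho hfin hε0 (m + 1)
  set ε' := min (1 / 2) (c' / 4) with hε'
  have hε'0 : 0 < ε' := by positivity
  have hε'1 : ε' ≤ 1 / 2 := min_le_left _ _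
  have hε'2 : ε' ≤ c' / 4 := min_le_right _ _
  have hsmall : ∀ᶠ N : ℕ in atTop,
      2 * Real.exp (-(1 / 2 * N)) + C * Real.exp (-(c' / 2 * N)) < ε := by
    have h1 := ((tendsto_exp_neg_mul_nat (c := 1 / 2) (by norm_num)).const_mul 2).add
      ((tendsto_exp_neg_mul_nat (c := c' / 2) (by positivity)).const_mul C)
    simp only [mul_zero, add_zero] at h1
    exact h1.eventually_lt_const hε0
  filter_upwards [hdev, hZ ε' hε'0, hU ε' hε'0 K, hsmall, eventually_gt_atTop 0] with
    N hdevN hZN hUN hsmallN hN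
  obtain ⟨P, Q, F, S, hPF, hP, hQS, hSK, hQ, hgood⟩ := hdevN
  obtain ⟨T, G, hTG, hGK, hT, hTle⟩ := hUN
  have hN' : (0 : ℝ) < N := by exact_mod_cast hN
  set Z := partitionFunction N γ b p with hZdef
  have hZ0 : 0 < Z := (Real.exp_pos _).trans_le hZN
  set H := hamiltonian N b p with hH
  have hHint := integrable_exp_neg_hamiltonian N γ b p
  rw [← hH] at hHint
  have hPm : MeasurableSet P := measurableSet_of_dependsOn hPF
  have hQTm : MeasurableSet (Q ∩ T) :=
    (measurableSet_of_dependsOn hQS).inter (measurableSet_of_dependsOn hTG)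
  have hQT : (edgeMeasure γ).real (Q ∩ T) ≤
      C * Real.exp (-(c' * N)) * Real.exp (-((m - ε') * N)) := by
    -- `Q` sees only edges shorter than K and `T` only edges of length at least K.
    rw [measureReal_inter_eq_mul_of_dependsOn γ hQS hTG]
    · gcongr
    · rw [Finset.disjoint_left]
      intro e he he'
      exact absurd (hSK e he) (not_lt.2 (hGK e he'))
  have hq01 : q ∈ Icc (0 : ℝ) 1 := ⟨measureReal_nonneg, measureReal_le_one⟩
  have hf01 : ∀ ω, patternCount h o' R N ω / N ∈ Icc (0 : ℝ) 1 := fun ω => by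
    have := patternCount_mem_Icc h o' R N ω
    exact ⟨div_nonneg this.1 hN'.le, (div_le_one hN').2 this.2⟩
  -- Off `P` and `Q` the frequency is within ε of q. On `Q` either the Hamiltonian exceeds (m + 1) N
  -- and the weight is tiny, or ω lies in `T`.
  have hpt : ∀ ω, |patternCount h o' R N ω / N - q| * Real.exp (-H ω) ≤
      ε * Real.exp (-H ω) + P.indicator (fun _ => 1) ω + (Q ∩ T).indicator (fun _ => 1) ω +
        Real.exp (-((m + 1) * N)) := by
    intro ω
    have hH0 : 0 ≤ H ω := hamiltonian_nonneg N b p ω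
    have he1 : Real.exp (-H ω) ≤ 1 := Real.exp_le_one_iff.2 (by linarith)
    have he0 := Real.exp_pos (-H ω)
    have hm0 := Real.exp_pos (-((m + 1) * N))
    have hd1 : |patternCount h o' R N ω / N - q| ≤ 1 := by
      rw [abs_le]
      have := hf01 ω
      exact ⟨by linarith [this.1, hq01.2], by linarith [this.2, hq01.1]⟩
    have hd0 := abs_nonneg (patternCount h o' R N ω / N - q)
    have hPi := (indicator_one_mem_Icc P ω).1
    have hQi := (indicator_one_mem_Icc (Q ∩ T) ω).1
    have hεe : 0 ≤ ε * Real.exp (-H ω) := by positivity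
    by_cases hPω : ω ∈ P
    · have : P.indicator (fun _ => (1 : ℝ)) ω = 1 := Set.indicator_of_mem hPω _
      rw [this]
      nlinarith
    by_cases hQω : ω ∈ Q
    · by_cases hle : H ω ≤ (m + 1) * N
      · have : (Q ∩ T).indicator (fun _ => (1 : ℝ)) ω = 1 :=
          Set.indicator_of_mem (Set.mem_inter hQω (hT ω hle)) _
        rw [this]
        nlinarith
      · have : Real.exp (-H ω) ≤ Real.exp (-((m + 1) * N)) := Real.exp_le_exp.2 (by linarith)
        nlinarith
    · have := mul_le_mul_of_nonneg_right (hgood ω hPω hQω) he0.le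
      linarith
  have hmeas : Measurable fun ω => patternCount h o' R N ω / N :=
    (measurable_patternCount h o' hR N).div_const _
  have hfint : Integrable (fun ω => patternCount h o' R N ω / N * Real.exp (-H ω))
      (edgeMeasure γ) := by
    refine hHint.bdd_mul (c := 1) hmeas.aestronglyMeasurable (Eventually.of_forall fun ω => ?_)
    rw [Real.norm_eq_abs, abs_of_nonneg (hf01 ω).1]
    exact (hf01 ω).2
  have hdint : Integrable (fun ω => (patternCount h o' R N ω / N - q) * Real.exp (-H ω))
      (edgeMeasure γ) := by
    simp only [sub_mul]
    exact hfint.sub (hHint.const_mul q)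
  have heq : (∫ ω, patternCount h o' R N ω / N * Real.exp (-H ω) ∂edgeMeasure γ) / Z - q =
      (∫ ω, (patternCount h o' R N ω / N - q) * Real.exp (-H ω) ∂edgeMeasure γ) / Z := by
    simp only [sub_mul]
    rw [integral_sub hfint (hHint.const_mul q), integral_const_mul, sub_div]
    congr 1
    exact (mul_div_cancel_right₀ q hZ0.ne').symm
  have hbound : |∫ ω, (patternCount h o' R N ω / N - q) * Real.exp (-H ω) ∂edgeMeasure γ| ≤
      ε * Z + Real.exp (-((m + 1) * N)) +
        C * Real.exp (-(c' * N)) * Real.exp (-((m - ε') * N)) + Real.exp (-((m + 1) * N)) := by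
    refine abs_integral_le_integral_abs.trans ?_
    have hi1 : Integrable (P.indicator fun _ => (1 : ℝ)) (edgeMeasure γ) :=
      (integrable_const _).indicator hPm
    have hi2 : Integrable ((Q ∩ T).indicator fun _ => (1 : ℝ)) (edgeMeasure γ) :=
      (integrable_const _).indicator hQTm
    have hi3 : Integrable (fun ω => ε * Real.exp (-H ω) + P.indicator (fun _ => (1 : ℝ)) ω)
        (edgeMeasure γ) := (hHint.const_mul ε).add hi1
    have hi4 : Integrable (fun ω => ε * Real.exp (-H ω) + P.indicator (fun _ => (1 : ℝ)) ω +
        (Q ∩ T).indicator (fun _ => (1 : ℝ)) ω) (edgeMeasure γ) := hi3.add hi2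
    refine (integral_mono hdint.abs (hi4.add
      (integrable_const (Real.exp (-((m + 1) * N))))) fun ω => ?_).trans ?_
    · simp only [Pi.add_apply, abs_mul, Real.abs_exp]
      exact hpt ω
    · simp only [Pi.add_apply]
      rw [integral_add hi4 (integrable_const _), integral_add hi3 hi2,
        integral_add (hHint.const_mul ε) hi1, integral_const_mul]
      have h1 : ∫ ω, P.indicator (fun _ => (1 : ℝ)) ω ∂edgeMeasure γ = (edgeMeasure γ).real P :=
        integral_indicator_one hPm
      have h2 : ∫ ω, (Q ∩ T).indicator (fun _ => (1 : ℝ)) ω ∂edgeMeasure γ =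
          (edgeMeasure γ).real (Q ∩ T) := integral_indicator_one hQTm
      rw [h1, h2]
      have h3 : ∫ _, Real.exp (-((m + 1) * N)) ∂edgeMeasure γ = Real.exp (-((m + 1) * N)) := by
        simp
      rw [h3]
      exact add_le_add (add_le_add (add_le_add le_rfl hP) hQT) le_rfl
  rw [Real.dist_eq, heq, abs_div, abs_of_pos hZ0, div_lt_iff₀ hZ0]
  refine hbound.trans_lt ?_
  have h1 : Real.exp (-((m + 1) * N)) ≤ Real.exp (-(1 / 2 * N)) * Z := by
    refine le_trans ?_ (mul_le_mul_of_nonneg_left hZN (Real.exp_pos _).le)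
    rw [← Real.exp_add]
    exact Real.exp_le_exp.2 (by nlinarith)
  have h2 : C * Real.exp (-(c' * N)) * Real.exp (-((m - ε') * N)) ≤
      C * Real.exp (-(c' / 2 * N)) * Z := by
    refine le_trans ?_ (mul_le_mul_of_nonneg_left hZN (by positivity))
    rw [mul_assoc, mul_assoc, ← Real.exp_add, ← Real.exp_add]
    refine mul_le_mul_of_nonneg_left (Real.exp_le_exp.2 ?_) hC.le
    nlinarith
  have h3 := mul_lt_mul_of_pos_right hsmallN hZ0
  have h4 : 0 < ε * Z := by positivity
  have h5 : ε₀ = 3 * ε := by rw [hε]; ring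
  rw [h5]
  nlinarith

/-! ### From configurations to Gibbs measures on graphs -/

theorem finite_range_finiteGraph (N : ℕ) : (Set.range (finiteGraph N)).Finite := by
  have hdep : DependsOn (finiteGraph N) (longEdges N 1 : Set (Sym2 ℤ)) := fun ω ω' h =>
    Subtype.ext (dependsOn_graphOf_segment N h)
  obtain ⟨φ, hφ⟩ := exists_comp_restrict_of_dependsOn hdep
  refine (Set.finite_range φ).subset ?_
  rintro _ ⟨ω, rfl⟩
  exact ⟨_, (hφ ω).symm⟩

/-- The reference measure is carried by finitely many graphs, so no measurability of the energy on
all graphs is needed. -/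
theorem aemeasurable_finiteRef (N : ℕ) (γ : ℝ) (f : LFGraph → ℝ) :
    AEMeasurable f (finiteRef N γ) := by
  have hfin := finite_range_finiteGraph N
  refine ⟨(Set.range (finiteGraph N)).indicator f, ?_, ?_⟩
  · refine measurable_of_measurable_on_compl_finite _ hfin ?_
    have : (Set.range (finiteGraph N))ᶜ.domRestrict ((Set.range (finiteGraph N)).indicator f) =
        fun _ => 0 := by
      funext x
      exact Set.indicator_of_notMem x.2 _
    rw [this]
    exact measurable_const
  · have hmem : ∀ᵐ g ∂finiteRef N γ, g ∈ Set.range (finiteGraph N) := by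
      rw [finiteRef_eq_map]
      exact ae_map_mem_range _ hfin.measurableSet _
    filter_upwards [hmem] with g hg
    exact (Set.indicator_of_mem hg f).symm

theorem integral_finiteRef (N : ℕ) (γ : ℝ) (f : LFGraph → ℝ) {s : Set LFGraph}
    (hs : MeasurableSet s) :
    ∫ g in s, f g ∂finiteRef N γ = ∫ ω in finiteGraph N ⁻¹' s, f (finiteGraph N ω) ∂edgeMeasure γ := by
  have h := (aemeasurable_finiteRef N γ f).aestronglyMeasurable
  rw [finiteRef_eq_map] at h ⊢
  exact setIntegral_map hs h (measurable_finiteGraph N).aemeasurable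

theorem gibbs_apply (N : ℕ) (γ b : ℝ) (p : ℝ≥0∞) {s : Set LFGraph} (hs : MeasurableSet s) :
    gibbs N γ b p s = ENNReal.ofReal ((∫ ω, (finiteGraph N ⁻¹' s).indicator (fun _ => 1) ω *
      Real.exp (-hamiltonian N b p ω) ∂edgeMeasure γ) / partitionFunction N γ b p) := by
  rw [gibbs, tilted_apply_eq_ofReal_integral' _ hs, integral_finiteRef N γ _ hs]
  have hZ : ∫ g, Real.exp (-((N : ℝ) ^ b * (energy p g.1).toReal)) ∂finiteRef N γ =
      partitionFunction N γ b p := by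
    have h := integral_finiteRef N γ (fun g => Real.exp (-((N : ℝ) ^ b * (energy p g.1).toReal)))
      MeasurableSet.univ
    simp only [Measure.restrict_univ, Set.preimage_univ] at h
    exact h
  rw [hZ, integral_div, ← integral_indicator (measurable_finiteGraph N hs)]
  congr 3
  funext ω
  by_cases hω : ω ∈ finiteGraph N ⁻¹' s
  · rw [Set.indicator_of_mem hω, Set.indicator_of_mem hω, one_mul]
    rfl
  · rw [Set.indicator_of_notMem hω, Set.indicator_of_notMem hω, zero_mul]

theorem segment_eq_coe (N : ℕ) : segment N = (Finset.Icc (1 : ℤ) N : Finset ℤ) := by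
  simp [segment]

theorem measurableSet_rootedEq_prod (h : GraphOnZ) (o' : ℤ) {R : ℝ} (hR : 0 ≤ R) :
    MeasurableSet {q : LFGraph × ℤ | RootedEq (ball q.1.1 q.2 R) q.2 h o'} := by
  refine measurableSet_setOfPred.2 (measurable_from_prod_countable_left fun o => ?_)
  exact measurableSet_setOfPred.1 (measurable_subtype_coe (measurableSet_rootedEq_ball o o' h hR))

theorem gibbs_prod_apply {N : ℕ} (hN : 0 < N) (γ b : ℝ) (p : ℝ≥0∞) (h : GraphOnZ) (o' : ℤ) {R : ℝ}
    (hR : 0 ≤ R) :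
    ((gibbs N γ b p).prod (uniformOn (segment N)))
      {q | RootedEq (ball q.1.1 q.2 R) q.2 h o'} =
      ENNReal.ofReal ((∫ ω, patternCount h o' R N ω / N *
        Real.exp (-hamiltonian N b p ω) ∂edgeMeasure γ) / partitionFunction N γ b p) := by
  have hN' : (0 : ℝ) < N := by exact_mod_cast hN
  have hne : (segment N).Nonempty := ⟨1, by simp [segment]; omega⟩
  have hfin : (segment N).Finite := Set.finite_Icc _ _
  have hprob : IsProbabilityMeasure (uniformOn (segment N)) := isProbabilityMeasure_uniformOn hfin hne
  have hsf : SFinite (gibbs N γ b p) := by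
    unfold gibbs Measure.tilted finiteRef
    infer_instance
  set Z := partitionFunction N γ b p with hZ
  have hZ0 : 0 ≤ Z := integral_nonneg fun ω => (Real.exp_pos _).le
  rw [Measure.prod_apply_symm (measurableSet_rootedEq_prod h o' hR)]
  have h1 : ∀ o : ℤ, gibbs N γ b p
      ((fun g => (g, o)) ⁻¹' {q : LFGraph × ℤ | RootedEq (ball q.1.1 q.2 R) q.2 h o'}) =
      ENNReal.ofReal ((∫ ω, (patternEvent h o' R (segment N) o).indicator (fun _ => 1) ω *
      Real.exp (-hamiltonian N b p ω) ∂edgeMeasure γ) / Z) := fun o =>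
    gibbs_apply N γ b p (measurable_subtype_coe (measurableSet_rootedEq_ball o o' h hR))
  simp only [h1]
  have hint : ∀ o, Integrable (fun ω => (patternEvent h o' R (segment N) o).indicator (fun _ => 1) ω *
      Real.exp (-hamiltonian N b p ω)) (edgeMeasure γ) := fun o => by
    refine (integrable_exp_neg_hamiltonian N γ b p).bdd_mul (c := 1)
      (measurable_const.indicator (measurableSet_patternEvent h o' hR _ o)).aestronglyMeasurable
      (Eventually.of_forall fun ω => ?_)
    have := indicator_one_mem_Icc (patternEvent h o' R (segment N) o) ω
    rw [Real.norm_eq_abs, abs_of_nonneg this.1]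
    exact this.2
  rw [uniformOn, ProbabilityTheory.cond, lintegral_smul_measure, segment_eq_coe, ← segment_eq_coe,
    Measure.count_apply_finite _ hfin]
  have h2 : ∀ f : ℤ → ℝ≥0∞, ∫⁻ o in segment N, f o ∂Measure.count =
      ∑ o ∈ Finset.Icc (1 : ℤ) N, f o := by
    intro f
    rw [segment_eq_coe, lintegral_finset]
    simp
  have h3 : hfin.toFinset.card = N := by
    have : hfin.toFinset = Finset.Icc (1 : ℤ) N := by
      ext x; simp [segment]
    rw [this, Int.card_Icc]
    simp
  rw [h2, h3, ← ENNReal.ofReal_sum_of_nonneg fun o _ => div_nonneg (integral_nonneg fun ω =>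
    mul_nonneg (indicator_one_mem_Icc _ ω).1 (Real.exp_pos _).le) hZ0, ← Finset.sum_div,
    ← integral_finsetSum _ fun o _ => hint o]
  simp only [← Finset.sum_mul]
  rw [smul_eq_mul, ← ENNReal.ofReal_natCast, ← ENNReal.ofReal_inv_of_pos hN',
    ← ENNReal.ofReal_mul (by positivity)]
  congr 1
  rw [← mul_div_assoc, ← integral_const_mul]
  congr 2
  funext ω
  rw [patternCount]
  ring

theorem infiniteRef_prod_apply {γ : ℝ} (hγ : 0 < γ) (h : GraphOnZ) (o' : ℤ) {R : ℝ} (hR : 0 ≤ R) :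
    ((infiniteRef γ).prod (Measure.dirac 0)) {q | RootedEq (ball q.1.1 q.2 R) q.2 h o'} =
      edgeMeasure γ (patternEvent h o' R univ 0) := by
  have hsf : SFinite (infiniteRef γ) := by
    unfold infiniteRef
    infer_instance
  rw [Measure.prod_apply_symm (measurableSet_rootedEq_prod h o' hR), lintegral_dirac]
  exact refMeasure_preimage γ univ (ae_isLocallyFinite hγ univ)
    (measurableSet_rootedEq_ball 0 o' h hR)

/-- Only finite patterns matter: balls in locally finite graphs are finite, so an infinite pattern
gives the empty event. -/
theorem locallyConvergesInDistribution_of_tendsto {γ b : ℝ} {p : ℝ≥0∞} (hγ : 0 < γ)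
    (H : ∀ (h : GraphOnZ) (o' : ℤ) (R : ℝ), 0 ≤ R → o' ∈ h.verts → h.verts.Finite →
      Tendsto (fun N : ℕ => (∫ ω, patternCount h o' R N ω / N *
      Real.exp (-hamiltonian N b p ω) ∂edgeMeasure γ) / partitionFunction N γ b p) atTop
      (𝓝 ((edgeMeasure γ).real (patternEvent h o' R univ 0)))) :
    LocallyConvergesInDistribution (fun N => (gibbs N γ b p).prod (uniformOn (segment N)))
      ((infiniteRef γ).prod (Measure.dirac 0)) := by
  intro R hR g o' ho
  by_cases hfin : g.1.verts.Finite
  · rw [infiniteRef_prod_apply hγ g.1 o' hR.le, ← ofReal_measureReal]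
    refine Tendsto.congr' ?_ ((ENNReal.continuous_ofReal.tendsto _).comp (H g.1 o' R hR.le ho hfin))
    filter_upwards [eventually_gt_atTop 0] with N hN
    rw [gibbs_prod_apply hN γ b p g.1 o' hR.le]
    rfl
  · have : {q : LFGraph × ℤ | RootedEq (ball q.1.1 q.2 R) q.2 g.1 o'} = ∅ := by
      refine Set.eq_empty_of_forall_notMem fun q hq => hfin ?_
      rw [← show translate q.2 o' (ball q.1.1 q.2 R) = g.1 from hq]
      exact (finite_ball_verts q.1.2 hR.le q.2).image _
    simp only [this, measure_empty]
    exact tendsto_const_nhds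

/-! ### Asymptotics and the three regimes -/

theorem eventually_const_mul_rpow_le {s : ℝ} (hs : s < 1) (C : ℝ) {ε : ℝ} (hε : 0 < ε) :
    ∀ᶠ N : ℕ in atTop, C * (N : ℝ) ^ s ≤ ε * N := by
  have h := ((tendsto_rpow_neg_atTop (sub_pos.2 hs)).comp tendsto_natCast_atTop_atTop).const_mul C
  rw [mul_zero] at h
  filter_upwards [h.eventually_le_const hε, eventually_gt_atTop 0] with N hN hN0
  have hN' : (0 : ℝ) < N := by exact_mod_cast hN0
  simp only [Function.comp_apply, neg_sub] at hN
  rw [Real.rpow_sub_one hN'.ne', mul_div_assoc', div_le_iff₀ hN'] at hN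
  exact hN

/-- The ratio of the hierarchy of `M` layers on `[N]`. -/
noncomputable def layerRatio (N M : ℕ) : ℕ := ⌈(N : ℝ) ^ (1 / (M + 1) : ℝ)⌉₊

theorem rpow_le_layerRatio (N M : ℕ) : (N : ℝ) ^ (1 / (M + 1) : ℝ) ≤ layerRatio N M :=
  Nat.le_ceil _

/-- With L ≈ N^(1/(M+1)) the energy term has order N^(b + 1/(M+1)) = o(N), so only the cost of
opening the layers remains. -/
theorem exp_neg_le_partitionFunction_of_cost {γ b m : ℝ} {p : ℝ≥0∞} (hp : 1 ≤ p) (M : ℕ)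
    (hγ : M = 0 ∨ γ ≤ 1) (hb : b + 1 / (M + 1) < 1)
    (hcost : ∀ ε > 0, ∀ᶠ N : ℕ in atTop,
      M * (N * (layerRatio N M : ℝ) ^ (γ - 1)) ≤ (m + ε) * N) :
    ∀ ε > 0, ∀ᶠ N : ℕ in atTop, Real.exp (-((m + ε) * N)) ≤ partitionFunction N γ b p := by
  intro ε hε
  filter_upwards [hcost (ε / 2) (by positivity),
    eventually_const_mul_rpow_le hb (4 * (M + 1)) (ε := ε / 2) (by positivity),
    eventually_gt_atTop 0] with N hN1 hN2 hN0
  have hN1' : (1 : ℝ) ≤ N := by exact_mod_cast hN0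
  have hM : (0 : ℝ) < 1 / (M + 1) := by positivity
  have hone : (1 : ℝ) ≤ (N : ℝ) ^ (1 / (M + 1) : ℝ) := Real.one_le_rpow hN1' hM.le
  have hL1 : 1 ≤ layerRatio N M := by
    exact_mod_cast hone.trans (rpow_le_layerRatio N M)
  have hLN : N ≤ layerRatio N M ^ (M + 1) := by
    have h := pow_le_pow_left₀ (by positivity) (rpow_le_layerRatio N M) (M + 1)
    rw [← Real.rpow_natCast, ← Real.rpow_mul (by positivity)] at h
    push_cast at h
    rw [one_div_mul_cancel (by positivity), Real.rpow_one] at h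
    exact_mod_cast h
  have hL2 : (layerRatio N M : ℝ) ≤ 2 * (N : ℝ) ^ (1 / (M + 1) : ℝ) := by
    have := (Nat.ceil_lt_add_one (a := (N : ℝ) ^ (1 / (M + 1) : ℝ)) (by positivity)).le
    unfold layerRatio
    linarith
  refine le_trans (Real.exp_le_exp.2 (neg_le_neg ?_))
    (exp_neg_le_partitionFunction hL1 hLN γ b hp hγ)
  have h3 : (N : ℝ) ^ b * (2 * ((M + 1) * layerRatio N M)) ≤ ε / 2 * N := by
    refine le_trans ?_ hN2
    rw [Real.rpow_add (by positivity)]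
    calc (N : ℝ) ^ b * (2 * ((M + 1) * layerRatio N M))
        ≤ (N : ℝ) ^ b * (2 * ((M + 1) * (2 * (N : ℝ) ^ (1 / (M + 1) : ℝ)))) := by gcongr
      _ = _ := by ring
  linarith

theorem le_edgeLength_of_mem_longEdges {N K : ℕ} {e : Sym2 ℤ} (he : e ∈ longEdges N K) :
    (K : ℤ) ≤ edgeLength e := by
  induction e with
  | _ x y => exact (mk_mem_longEdges.1 he).2.2

theorem dependsOn_openLength (N K : ℕ) (a : ℝ) :
    DependsOn (· ∈ {ω | a ≤ openLength N K ω}) (longEdges N K : Set (Sym2 ℤ)) := fun ω ω' h => by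
  have : openLength N K ω = openLength N K ω' :=
    Finset.sum_congr rfl fun e he => by rw [h e he]
  simp only [Set.mem_ofPred_eq, this]

/-- For `b > (k - 1) / k`, a small energy forces the long edges to have total length about `k N`. -/
theorem eventually_le_openLength {b : ℝ} {p : ℝ≥0∞} (hp : 1 ≤ p) {k : ℕ} (hk : 1 ≤ k)
    (hb1 : b < 1) (hb : (1 - b) * k < 1) {K : ℕ} (hK : 2 ≤ K) {η : ℝ} (hη : 0 < η) :
    ∀ᶠ N : ℕ in atTop, ∀ ω, hamiltonian N b p ω ≤ (k + 1) * N →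
      (k - η) * N ≤ openLength N K ω := by
  have hk0 : (0 : ℝ) < k := by exact_mod_cast hk
  -- The radius t will be (2k/η + 1) h rounded up, and A N^(1-b) bounds it. The factor makes the
  -- Markov fraction h/t at most η/(2k), half of the density η/k of thin cuts; the tree bound is of
  -- order N^((1-b)k) = o(N) and takes at most another quarter of η/k.
  set A : ℝ := (2 * k / η + 1) * (k + 1) + 1 with hA
  have hA0 : 0 < A := by positivity
  filter_upwards [eventually_const_mul_rpow_le hb (K * (4 * A) ^ k) (ε := η / (4 * k))
    (by positivity), eventually_gt_atTop 0] with N hN hN0 ω hω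
  have hN' : (0 : ℝ) < N := by exact_mod_cast hN0
  have hN1 : (1 : ℝ) ≤ N := by exact_mod_cast hN0
  by_contra! hL
  set h : ℝ := (k + 1) * (N : ℝ) ^ (1 - b) with hh
  have hpow : 1 ≤ (N : ℝ) ^ (1 - b) := Real.one_le_rpow hN1 (by linarith)
  have hh0 : 0 < h := by positivity
  have hE : energy p (graphOf (segment N) ω) ≤ ENNReal.ofReal h := by
    rw [← ENNReal.ofReal_toReal (energy_ne_top hp N ω)]
    refine ENNReal.ofReal_le_ofReal ?_
    rw [hamiltonian] at hω
    rw [hh, Real.rpow_sub hN', Real.rpow_one, mul_div_assoc', le_div_iff₀ (by positivity)]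
    linarith
  set t : ℕ := ⌈(2 * k / η + 1) * h⌉₊ with ht
  have hc : 0 < 2 * k / η := by positivity
  have htle : (2 * k / η + 1) * h ≤ t := Nat.le_ceil _
  have ht0 : (0 : ℝ) < t := lt_of_lt_of_le (by positivity) htle
  have hht : h ≤ t := by nlinarith
  have htA : (t : ℝ) ≤ A * (N : ℝ) ^ (1 - b) := by
    have := (Nat.ceil_lt_add_one (a := (2 * k / η + 1) * h) (by positivity)).le
    calc (t : ℝ) ≤ (2 * k / η + 1) * h + 1 := this
      _ ≤ (2 * k / η + 1) * h + (N : ℝ) ^ (1 - b) := by linarith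
      _ = A * (N : ℝ) ^ (1 - b) := by rw [hA, hh]; ring
  have hmain := lower_bound_of_energy_le hp hN0 hK hk (by exact_mod_cast ht0) hh0.le hht hE hL
  have h1 : h / t ≤ η / (2 * k) := by
    rw [div_le_div_iff₀ ht0 (by positivity)]
    have : 2 * k / η * h ≤ t := by nlinarith
    rw [div_mul_eq_mul_div, div_le_iff₀ hη] at this
    linarith
  have h2 : K * (4 * t : ℝ) ^ k ≤ η / (4 * k) * N := by
    refine le_trans ?_ hN
    calc K * (4 * t : ℝ) ^ k ≤ K * (4 * (A * (N : ℝ) ^ (1 - b))) ^ k := by gcongr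
      _ = K * (4 * A) ^ k * (N : ℝ) ^ ((1 - b) * k) := by
        rw [Real.rpow_mul hN'.le, Real.rpow_natCast, ← mul_assoc, mul_pow, mul_assoc]
  have h3 : h / t * N ≤ η / (2 * k) * N := by gcongr
  have h4 : η * N / k = η / (2 * k) * N + η / (4 * k) * N + η / (4 * k) * N := by
    field_simp; norm_num
  have h5 : 0 < η / (4 * k) * N := by positivity
  linarith

theorem locallyConverges_of_cost {γ b : ℝ} {p : ℝ≥0∞} (hp : 1 ≤ p) (hγ : 0 < γ) (M : ℕ)
    (hM : M = 0 ∨ γ ≤ 1) (hb : b + 1 / (M + 1) < 1)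
    (hcost : ∀ ε > 0, ∀ᶠ N : ℕ in atTop,
      M * (N * (layerRatio N M : ℝ) ^ (γ - 1)) ≤ (0 + ε) * N) :
    LocallyConvergesInDistribution (fun N => (gibbs N γ b p).prod (uniformOn (segment N)))
      ((infiniteRef γ).prod (Measure.dirac 0)) := by
  refine locallyConvergesInDistribution_of_tendsto hγ fun h o' R hR ho hfin =>
    tendsto_gibbs_patternCount hγ (exp_neg_le_partitionFunction_of_cost hp M hM hb hcost) ?_
      hR ho hfin
  intro ε hε K
  -- For m = 0 no constraint on the long edges is needed: T is the whole space.
  refine Eventually.of_forall fun N => ⟨univ, ∅, fun _ _ _ => rfl, by simp, fun _ _ => trivial, ?_⟩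
  rw [probReal_univ, Real.one_le_exp_iff]
  have : (0 : ℝ) ≤ N := Nat.cast_nonneg N
  nlinarith

theorem locallyConverges_of_neg {γ b : ℝ} {p : ℝ≥0∞} (hp : 1 ≤ p) (hγ : 0 < γ) (hb : b < 0) :
    LocallyConvergesInDistribution (fun N => (gibbs N γ b p).prod (uniformOn (segment N)))
      ((infiniteRef γ).prod (Measure.dirac 0)) := by
  refine locallyConverges_of_cost hp hγ 0 (Or.inl rfl) (by simpa using hb) fun ε hε => ?_
  refine Eventually.of_forall fun N => ?_
  simp only [Nat.cast_zero, zero_mul, zero_add]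
  positivity

/-- Enough layers bring the energy to o(N) for any b < 1, and each layer costs at most N L^(γ-1) =
o(N). -/
theorem locallyConverges_of_lt_one {γ b : ℝ} {p : ℝ≥0∞} (hp : 1 ≤ p) (hγ : 0 < γ) (hγ1 : γ < 1)
    (hb : b < 1) :
    LocallyConvergesInDistribution (fun N => (gibbs N γ b p).prod (uniformOn (segment N)))
      ((infiniteRef γ).prod (Measure.dirac 0)) := by
  obtain ⟨M, hM⟩ := exists_nat_one_div_lt (sub_pos.2 hb)
  refine locallyConverges_of_cost hp hγ M (Or.inr hγ1.le) (by linarith) fun ε hε => ?_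
  have hs : 1 / (M + 1 : ℝ) * (γ - 1) + 1 < 1 := by
    have : 0 < 1 / (M + 1 : ℝ) := by positivity
    nlinarith
  filter_upwards [eventually_const_mul_rpow_le hs M hε, eventually_gt_atTop 0] with N hN hN0
  have hN' : (0 : ℝ) < N := by exact_mod_cast hN0
  rw [zero_add]
  refine le_trans ?_ hN
  rw [Real.rpow_add_one hN'.ne', Real.rpow_mul hN'.le, mul_comm (N : ℝ)]
  have := Real.rpow_le_rpow_of_nonpos (Real.rpow_pos_of_pos hN' (1 / (M + 1 : ℝ)))
    (rpow_le_layerRatio N M) (show γ - 1 ≤ 0 by linarith)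
  gcongr

/-- The hypotheses say (k-1)/k < b < k/(k+1): k layers suffice at cost kN, and by the cut argument
long edges of total length about kN are also necessary. -/
theorem locallyConverges_of_eq_one {b : ℝ} {p : ℝ≥0∞} (hp : 1 ≤ p) {k : ℕ} (hk : 1 ≤ k)
    (hb1 : b < 1) (hb2 : b + 1 / (k + 1) < 1) (hb3 : (1 - b) * k < 1) :
    LocallyConvergesInDistribution (fun N => (gibbs N 1 b p).prod (uniformOn (segment N)))
      ((infiniteRef 1).prod (Measure.dirac 0)) := by
  refine locallyConvergesInDistribution_of_tendsto zero_lt_one fun h o' R hR ho hfin =>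
    tendsto_gibbs_patternCount zero_lt_one (m := k)
      (exp_neg_le_partitionFunction_of_cost hp k (Or.inr le_rfl) hb2 fun ε hε => ?_) ?_ hR ho hfin
  · refine Eventually.of_forall fun N => ?_
    rw [sub_self, Real.rpow_zero, mul_one]
    gcongr
    linarith
  · intro ε hε K
    obtain ⟨K₀, hK₀⟩ := exists_edgeMeasure_openLength_le (m := k) (Nat.cast_nonneg k)
      (ε := ε / 3) (by positivity)
    -- The constraint may be put on even longer edges: K' ≥ K keeps it independent of the short
    -- edges, and K' ≥ K₀ makes the tail bound available.
    set K' := max K (max 2 K₀) with hK'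
    have h1 : K ≤ K' := le_max_left _ _
    have h2 : 2 ≤ K' := (le_max_left _ _).trans (le_max_right _ _)
    have h3 : K₀ ≤ K' := (le_max_right _ _).trans (le_max_right _ _)
    filter_upwards [eventually_le_openLength hp hk hb1 hb3 h2 (η := ε / 3) (by positivity)]
      with N hN
    refine ⟨_, _, dependsOn_openLength N K' ((k - ε / 3) * N), fun e he => ?_, hN, ?_⟩
    · have := le_edgeLength_of_mem_longEdges he
      omega
    · have := hK₀ K' h3 N
      rwa [show (k : ℝ) - 3 * (ε / 3) = k - ε by ring] at this

theorem sub_one_div_mem_exceptionalSet (p : ℝ≥0∞) {k : ℕ} (hk : 1 ≤ k) :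
    ((k : ℝ) - 1) / k ∈ exceptionalSet p := by
  unfold exceptionalSet
  split_ifs with hp
  · rcases Nat.eq_or_lt_of_le hk with rfl | hk2
    · left
      norm_num
    · right
      exact Set.mem_iUnion₂.2 ⟨k, hk2, rfl⟩
  · refine Set.mem_iUnion₂.2 ⟨k, hk, le_rfl, ?_⟩
    exact le_add_of_nonneg_right (le_max_left _ _)

/-- Outside of the exceptional set, `b` lies strictly between two consecutive points `(k - 1) / k`
and `k / (k + 1)`. -/
theorem exists_layer_number {p : ℝ≥0∞} {b : ℝ} (hb0 : 0 ≤ b) (hb1 : b < 1)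
    (hb : b ∉ exceptionalSet p) :
    ∃ k : ℕ, 1 ≤ k ∧ b + 1 / (k + 1) < 1 ∧ (1 - b) * k < 1 := by
  have hpos : 0 < 1 - b := by linarith
  -- This is the largest k with (k-1)/k ≤ b; equality is excluded because these points belong to the
  -- exceptional set.
  set k := ⌊1 / (1 - b)⌋₊ with hk
  have h1 : 1 ≤ k := by
    refine Nat.le_floor ?_
    rw [Nat.cast_one, le_div_iff₀ hpos]
    linarith
  have hk0 : (0 : ℝ) < k := by exact_mod_cast h1
  have h2 : (k : ℝ) ≤ 1 / (1 - b) := Nat.floor_le (by positivity)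
  have h3 : 1 / (1 - b) < k + 1 := Nat.lt_floor_add_one _
  rw [le_div_iff₀ hpos] at h2
  rw [div_lt_iff₀ hpos] at h3
  refine ⟨k, h1, ?_, ?_⟩
  · rw [← lt_sub_iff_add_lt', div_lt_iff₀ (by positivity)]
    linarith
  · rw [mul_comm]
    refine lt_of_le_of_ne h2 fun heq => hb ?_
    have : b = ((k : ℝ) - 1) / k := by
      field_simp
      linarith
    rw [this]
    exact sub_one_div_mem_exceptionalSet p h1

end SpatialGibbs

theorem mainTheorem1 (p : ℝ≥0∞) (hp : 1 ≤ p) (γ b : ℝ)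
    (h : (0 < γ ∧ γ < 1 ∧ b < 1) ∨
      (γ = 1 ∧ b < 1 ∧ b ∉ SpatialGibbs.exceptionalSet p) ∨
      (1 < γ ∧ b < 0)) :
    SpatialGibbs.LocallyConvergesInDistribution
      (fun N => (SpatialGibbs.gibbs N γ b p).prod (uniformOn (SpatialGibbs.segment N)))
      ((SpatialGibbs.infiniteRef γ).prod (Measure.dirac 0)) := by
  rcases h with ⟨hγ, hγ1, hb⟩ | ⟨rfl, hb1, hb⟩ | ⟨hγ, hb⟩
  · exact SpatialGibbs.locallyConverges_of_lt_one hp hγ hγ1 hb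
  · rcases lt_or_ge b 0 with hb0 | hb0
    · exact SpatialGibbs.locallyConverges_of_neg hp zero_lt_one hb0
    · obtain ⟨k, hk, h2, h3⟩ := SpatialGibbs.exists_layer_number hb0 hb1 hb
      exact SpatialGibbs.locallyConverges_of_eq_one hp hk hb1 h2 h3
  · exact SpatialGibbs.locallyConverges_of_neg hp (zero_lt_one.trans hγ) hb
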